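/- **Setting.** Let $I=[a,b]\subset\mathbb R$, $a<b$, let $T:I\to I$, and let $I_1,\dots,I_\kappa\subset I$ be disjoint sets, $S=\{1,\dots,\kappa\}$. Write $\partial A=\overline A\setminus A$. Assume: * **(A1)** each $I_i$ is, up to finitely many points, a finite union of open intervals on which $T$ is continuous and one-to-one; $\overline{\bigcup_i I_i}=I$; $T(I_i)\subset\overline{I_i}$, and $T^{-1}(\partial I_i)\cap I_i$ is finite and non-empty; for all $i,j\in S$ there are $r\ge1$ and $i=i_0,i_1,\dots,i_r=j$ with $T(I_{i_l})\cap\partial I_{i_{l+1}}\neq\emptyset$ for $0\le l<r$. Let $(\Omega,\mathcal F,\mathbb P)$ be a probability space and, for $\epsilon>0$, let $T_\epsilon:\Omega\times I\to I$ be (jointly) measurable. Let $\mathbb M^x_\epsilon$ be the law of $T_\epsilon(\cdot,x)$. Assume: * **(A2)** $\mathbb M_\epsilon^x$ is absolutely continuous with respect to Lebesgue measure for all $x\in I$, $\epsilon>0$; * **(A3)** for some $\gamma_1,\gamma_2>0$ and all $\epsilon,t>0$, $\sup_{x\in I}\mathbb P(|T_\epsilon(\cdot,x)-T(x)|>t)\le\gamma_1\exp(-t^2/(\gamma_2\epsilon^2))$,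 and $\limsup_{\epsilon\to0}\max_{i}\sup_{x\in I_i}\mathbb P(T_\epsilon(\cdot,x)\notin I_i)=0$; * **(A4)** for each $\epsilon>0$ the Markov chain $X_{n+1}=T_\epsilon(\omega_n,X_n)$ ($\omega_n$ i.i.d. with law $\mathbb P$) has a unique absolutely continuous invariant probability measure $\mu_\epsilon$. *Wells.* For $i\ne j$ and $\epsilon>0$ let $B^\epsilon_{i,j}$ be either empty or a closed subset of $\overline{I_i}$ that contains $\partial I_i\cap\overline{I_j}$ and for which $\Delta^\epsilon_{i,j}:=T^{-1}(B^\epsilon_{i,j})\cap I_i$ is a finite union of intervals. Assume that $\Delta^\epsilon_{i,j}\cap\Delta^\epsilon_{i,j'}=\emptyset$ for $j\neq j'$. Put $\Delta_i^\epsilon=\bigcup_{j\neq i}\Delta^\epsilon_{i,j}$, $\Delta^\epsilon=\bigcup_i\Delta^\epsilon_i$, $\mathcal E_i^\epsilon=I_i\setminus\Delta_i^\epsilon$, $\check{\mathcal E}_i^\epsilon=\bigcup_{j\ne i}\mathcal E_j^\epsilon$, and assume $\mathrm{Leb}(\Delta^\epsilon)\to0$ as $\epsilon\to0$. *Process.*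 Let $\beta_\epsilon>0$ with $\beta_\epsilon\to\infty$ as $\epsilon\to0$. Let $\eta_\epsilon$ be the continuous-time jump process with embedded chain $X_n$ and independent mean one exponential waiting times, let $\xi_\epsilon(t)=\eta_\epsilon(\beta_\epsilon t)$, with law $\boldsymbol P^\epsilon_x$ when started from $x$, and let $(\mathcal L_\epsilon F)(x)=\beta_\epsilon\int[F(y)-F(x)]\,\mathbb M^x_\epsilon(dy)$ be its generator. Let $H(A)=\inf\{t\ge0:\xi_\epsilon(t)\in A\}$, $\tau_1=\inf\{t\ge 0:\xi_\epsilon(t)\ne\xi_\epsilon(0)\}$, $H^+(A)=\inf\{t\ge\tau_1:\xi_\epsilon(t)\in A\}$. For $\lambda>0$ and $g:S\to\mathbb R$ let $F_\epsilon$ be the unique bounded measurable solution of $(\lambda-\mathcal L_\epsilon)F_\epsilon=\sum_{i\in S} g(i)\chi_{\mathcal E_i^\epsilon}$ on $I$, and let $f_\epsilon(i)=\mu_\epsilon(\mathcal E_i^\epsilon)^{-1}\int_{\mathcal E_i^\epsilon}F_\epsilon\,d\mu_\epsilon$. **Proposition 3.4.** Assume moreover * **(A5)** $\lim_{\epsilon\to0}\mu_\epsilon(\mathcal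 E^\epsilon_i)$ exists and is positive for every $i\in S$, and $\lim_{\epsilon\to0}\mu_\epsilon(\Delta^\epsilon)=0$; * **(H0)** for all $i\ne j$ in $S$ the following limit exists in $\mathbb R$: $$\theta(i,j)=\lim_{\epsilon\to0}\frac{\beta_\epsilon}{\mu_\epsilon(\mathcal E_i^\epsilon)}\int_{\mathcal E_i^\epsilon}\boldsymbol P^\epsilon_x\big[H(\mathcal E_j^\epsilon)<H^+(\check{\mathcal E}_j^\epsilon)\big]\,\mu_\epsilon(dx).$$ Let $(\mathcal Lf)(i)=\sum_{j\in S}\theta(i,j)[f(j)-f(i)]$. Then for all $\lambda>0$ and $g:S\to\mathbb R$ for which * **($\mathfrak R^{(1)}$)** $\lim_{\epsilon\to0}\sup_{x,y\in\mathcal E_i^\epsilon}|F_\epsilon(x)-F_\epsilon(y)|=0$ for every $i\in S$, the reduced resolvent equation $(\lambda-\mathcal L)f=g$ has a unique solution $f:S\to\mathbb R$, and for every $i\in S$ * **($\mathfrak R^{(2)}_{\mathcal L}$)** $\lim_{\epsilon\to0}f_\epsilon(i)=f(i)$, and * **($\mathfrak R_{\mathcal L}$)** $\lim_{\epsilon\to0}\sup_{x\in\mathcal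 E_i^\epsilon}|F_\epsilon(x)-f(i)|=0$. (In particular, if $\mathfrak R^{(1)}$ holds for all $\lambda$ and $g$, so do $\mathfrak R^{(2)}_{\mathcal L}$ and $\mathfrak R_{\mathcal L}$.) -/

import Mathlib

open MeasureTheory ProbabilityTheory Filter Set Topology
open scoped NNReal ENNReal

noncomputable section

/-- The data: a map `T` of the interval `I = [a, b]`, a collection of `κ` subsets of `I`, a family
of random maps `T_ε : Ω × I → I` on a probability space `(Ω, P)`, the sets `B_{i,j}^ε` from which
the holes are built, measures `μ_ε` on `I` and time scales `β_ε`. The assumptions on these data are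
the predicates below. Only the values at `ε > 0` are ever used. -/
structure PerturbedMap (a b : ℝ) (κ : ℕ) (Ω : Type*) [MeasurableSpace Ω] where
  /-- the unperturbed map -/
  T : Icc a b → Icc a b
  /-- the sets `I_1, …, I_κ` -/
  comp : Fin κ → Set (Icc a b)
  /-- the law of the noise -/
  P : Measure Ω
  /-- it is a probability measure -/
  isProb : IsProbabilityMeasure P
  /-- the random maps `T_ε(ω, x)` -/
  Tε : ℝ → Ω → Icc a b → Icc a b
  /-- the sets `B_{i,j}^ε` -/
  B : ℝ → Fin κ → Fin κ → Set (Icc a b)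
  /-- the invariant measures `μ_ε` -/
  μ : ℝ → Measure (Icc a b)
  /-- the time scales `β_ε` -/
  β : ℝ → ℝ

/-- The boundary `∂A = closure A \ A` of a set. -/
def bdry {X : Type*} [TopologicalSpace X] (A : Set X) : Set X := closure A \ A

/-- A finite (possibly empty) union of intervals. -/
def IsFiniteUnionOfIntervals {a b : ℝ} (A : Set (Icc a b)) : Prop :=
  ∃ J : Set (Set (Icc a b)), J.Finite ∧ (∀ s ∈ J, s.OrdConnected) ∧ A = ⋃₀ J

/-- Lebesgue measure on the interval `[a, b]`. -/
def lebesgue (a b : ℝ) : Measure (Icc a b) := (volume : Measure ℝ).comap Subtype.val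

/-- The law of a mean one exponential random variable. -/
def expOne : Measure ℝ := expMeasure 1

instance : IsProbabilityMeasure expOne := isProbabilityMeasure_expMeasure one_pos

namespace PerturbedMap

variable {a b : ℝ} {κ : ℕ} {Ω : Type*} [MeasurableSpace Ω] (M : PerturbedMap a b κ Ω)

instance : IsProbabilityMeasure M.P := M.isProb

/-! ### The map and its invariant components -/

/-- The assumptions on the unperturbed map: the `I_i` are disjoint; each of them is, up to finitely
many points, a finite union of open intervals on which `T` is continuous and one-to-one; they
essentially cover `I`; each is invariant up to closure and contains finitely many, and at least one,
points which `T` sends to its boundary; and they communicate through their boundaries. -/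
structure MapAssumptions : Prop where
  disjoint : Pairwise fun i j => Disjoint (M.comp i) (M.comp j)
  decomp : ∀ i, ∃ (k : ℕ) (l r : Fin k → Icc a b),
    (∀ m, l m < r m) ∧ (∀ m, Ioo (l m) (r m) ⊆ M.comp i) ∧
    (M.comp i \ ⋃ m, Ioo (l m) (r m)).Finite ∧
    ∀ m, ContinuousOn M.T (Ioo (l m) (r m)) ∧ InjOn M.T (Ioo (l m) (r m))
  cover : closure (⋃ i, M.comp i) = univ
  mapsTo : ∀ i, MapsTo M.T (M.comp i) (closure (M.comp i))
  finite_infHoles : ∀ i, (M.T ⁻¹' bdry (M.comp i) ∩ M.comp i).Finite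
  nonempty_infHoles : ∀ i, (M.T ⁻¹' bdry (M.comp i) ∩ M.comp i).Nonempty
  communicate : ∀ i j,
    Relation.TransGen (fun k l => (M.T '' M.comp k ∩ bdry (M.comp l)).Nonempty) i j

/-! ### The random maps -/

/-- The law of `T_ε(·, x)`, that is the one-step transition probability of the chain from `x`. -/
def transitionLaw (ε : ℝ) (x : Icc a b) : Measure (Icc a b) := M.P.map fun ω => M.Tε ε ω x

/-- The random maps are measurable, their one-step laws are absolutely continuous, they concentrate
around `T` in a sub-Gaussian way, and the probability of escaping from a component in one step
tends to zero uniformly. -/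
structure NoiseAssumptions : Prop where
  measurable : ∀ ε > 0, Measurable fun q : Ω × Icc a b => M.Tε ε q.1 q.2
  absCont : ∀ ε > 0, ∀ x, M.transitionLaw ε x ≪ lebesgue a b
  subGaussian : ∃ γ₁ > (0 : ℝ), ∃ γ₂ > (0 : ℝ), ∀ ε > 0, ∀ t > 0,
    ⨆ x, M.P {ω | t < |(M.Tε ε ω x : ℝ) - (M.T x : ℝ)|}
      ≤ ENNReal.ofReal (γ₁ * Real.exp (-(t ^ 2 / (γ₂ * ε ^ 2))))
  barrier : limsup (fun ε => ⨆ i, ⨆ x ∈ M.comp i, M.P {ω | M.Tε ε ω x ∉ M.comp i}) (𝓝[>] 0) = 0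

/-- An absolutely continuous invariant probability measure of the chain. -/
structure IsACIM (ε : ℝ) (ν : Measure (Icc a b)) : Prop where
  isProb : IsProbabilityMeasure ν
  absCont : ν ≪ lebesgue a b
  invariant : ∀ A, MeasurableSet A → ∫⁻ x, M.transitionLaw ε x A ∂ν = ν A

/-- For every `ε > 0`, `μ_ε` is the unique absolutely continuous invariant probability measure. -/
def UniqueACIM : Prop :=
  ∀ ε > 0, M.IsACIM ε (M.μ ε) ∧ ∀ ν, M.IsACIM ε ν → ν = M.μ ε

/-! ### Holes and wells -/

/-- The hole `Δ_{i,j}^ε` from `I_i` to `I_j`. -/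
def hole (ε : ℝ) (i j : Fin κ) : Set (Icc a b) := M.T ⁻¹' M.B ε i j ∩ M.comp i

/-- The hole `Δ_i^ε`. -/
def holeOf (ε : ℝ) (i : Fin κ) : Set (Icc a b) := ⋃ j ∈ {j | j ≠ i}, M.hole ε i j

/-- The hole `Δ^ε`. -/
def holes (ε : ℝ) : Set (Icc a b) := ⋃ i, M.holeOf ε i

/-- The metastable well `𝓔_i^ε`. -/
def well (ε : ℝ) (i : Fin κ) : Set (Icc a b) := M.comp i \ M.holeOf ε i

/-- The union of all the wells but the `i`-th one. -/
def otherWells (ε : ℝ) (i : Fin κ) : Set (Icc a b) := ⋃ j ∈ {j | j ≠ i}, M.well ε j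

/-- The assumptions on the sets `B_{i,j}^ε` and on the holes that they define. -/
structure HoleAssumptions : Prop where
  choice : ∀ ε > 0, ∀ i j, i ≠ j →
    (IsClosed (M.B ε i j) ∧ M.B ε i j ⊆ closure (M.comp i) ∧
      bdry (M.comp i) ∩ closure (M.comp j) ⊆ M.B ε i j ∧
      IsFiniteUnionOfIntervals (M.hole ε i j)) ∨ M.B ε i j = ∅
  disjoint : ∀ ε > 0, ∀ i j k, j ≠ i → k ≠ i → j ≠ k → Disjoint (M.hole ε i j) (M.hole ε i k)
  lim_lebesgue : Tendsto (fun ε => lebesgue a b (M.holes ε)) (𝓝[>] 0) (𝓝 0)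

/-- The measure of every well has a positive limit and the measure of the holes tends to zero. -/
structure NoConcentration : Prop where
  wells : ∀ i, ∃ m > 0, Tendsto (fun ε => M.μ ε (M.well ε i)) (𝓝[>] 0) (𝓝 m)
  holes : Tendsto (fun ε => M.μ ε (M.holes ε)) (𝓝[>] 0) (𝓝 0)

/-- The time scales are positive and tend to infinity. -/
structure TimeScale : Prop where
  pos : ∀ ε > 0, 0 < M.β ε
  lim : Tendsto M.β (𝓝[>] 0) atTop

/-! ### The Markov jump process -/

/-- The chain `X_0 = x`, `X_{n+1} = T_ε(ω_n, X_n)`. -/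
def chain (ε : ℝ) (x : Icc a b) (ω : ℕ → Ω) : ℕ → Icc a b
  | 0 => x
  | n + 1 => M.Tε ε (ω n) (chain ε x ω n)

/-- The number of jumps up to time `t`, given the successive waiting times `w_0, w_1, …`. -/
def jumpCount (w : ℕ → ℝ) (t : ℝ) : ℕ := {n : ℕ | ∑ k ∈ Finset.range (n + 1), w k ≤ t}.ncard

/-- The probability space of the jump process: i.i.d. noises with law `P` and, independently,
i.i.d. mean one exponential waiting times. -/
def pathLaw : Measure ((ℕ → Ω) × (ℕ → ℝ)) :=
  (Measure.infinitePi fun _ : ℕ => M.P).prod (Measure.infinitePi fun _ : ℕ => expOne)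

/-- The jump process `η_ε(t)` started from `x`. -/
def η (ε : ℝ) (x : Icc a b) (q : (ℕ → Ω) × (ℕ → ℝ)) (t : ℝ) : Icc a b :=
  M.chain ε x q.1 (jumpCount q.2 t)

/-- The speeded-up process `ξ_ε(t) = η_ε(β_ε t)`, `t ≥ 0`, started from `x`. -/
def ξ (ε : ℝ) (x : Icc a b) (q : (ℕ → Ω) × (ℕ → ℝ)) (t : ℝ≥0) : Icc a b :=
  M.η ε x q (M.β ε * t)

/-- The hitting time of `A` by a trajectory (infinite if `A` is not visited). -/
def hit (y : ℝ≥0 → Icc a b) (A : Set (Icc a b)) : ℝ≥0∞ := ⨅ (t : ℝ≥0) (_ : y t ∈ A), (t : ℝ≥0∞)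

/-- The time of the first jump of a trajectory. -/
def firstJump (y : ℝ≥0 → Icc a b) : ℝ≥0∞ := ⨅ (t : ℝ≥0) (_ : y t ≠ y 0), (t : ℝ≥0∞)

/-- The time of the first visit to `A` after at least one jump. -/
def hitPlus (y : ℝ≥0 → Icc a b) (A : Set (Icc a b)) : ℝ≥0∞ :=
  ⨅ (t : ℝ≥0) (_ : firstJump y ≤ t ∧ y t ∈ A), (t : ℝ≥0∞)

/-- The probability, starting from `x`, that `ξ_ε` attains the `j`-th well before it visits,
after at least one jump, any other well. -/
def hitProb (ε : ℝ) (j : Fin κ) (x : Icc a b) : ℝ :=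
  M.pathLaw.real {q | hit (M.ξ ε x q) (M.well ε j) < hitPlus (M.ξ ε x q) (M.otherWells ε j)}

/-- The rates `θ_ε(i, j)`. -/
def rate (ε : ℝ) (i j : Fin κ) : ℝ :=
  M.β ε / (M.μ ε).real (M.well ε i) * ∫ x in M.well ε i, M.hitProb ε j x ∂(M.μ ε)

/-- The rates `θ_ε(i, j)`, `i ≠ j`, converge to `θ(i, j)`. -/
def RatesConverge (θ : Fin κ → Fin κ → ℝ) : Prop :=
  ∀ i j, i ≠ j → Tendsto (fun ε => M.rate ε i j) (𝓝[>] 0) (𝓝 (θ i j))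

/-! ### Resolvent equations -/

/-- The generator of the speeded-up process. -/
def generator (ε : ℝ) (F : Icc a b → ℝ) (x : Icc a b) : ℝ :=
  M.β ε * ∫ y, (F y - F x) ∂(M.transitionLaw ε x)

/-- The function equal to `g(i)` on the `i`-th well and to zero outside the wells. -/
def liftWells (ε : ℝ) (g : Fin κ → ℝ) (x : Icc a b) : ℝ :=
  ∑ i, g i * (M.well ε i).indicator 1 x

/-- `F` is a bounded measurable solution of `(λ - 𝓛_ε) F = G`. -/
structure IsResolventSolution (ε lam : ℝ) (g : Fin κ → ℝ) (F : Icc a b → ℝ) : Prop where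
  measurable : Measurable F
  bounded : ∃ C, ∀ x, |F x| ≤ C
  eq : ∀ x, lam * F x - M.generator ε F x = M.liftWells ε g x

/-- The solution `F_ε` of the resolvent equation; see `resolvent_spec`. -/
def resolvent (ε lam : ℝ) (g : Fin κ → ℝ) : Icc a b → ℝ :=
  Classical.epsilon (M.IsResolventSolution ε lam g)

section existence

lemma measurable_integral_transitionLaw {ε : ℝ}
    (hT : Measurable fun q : Ω × Icc a b => M.Tε ε q.1 q.2)
    {F : Icc a b → ℝ} (hF : Measurable F) :
    Measurable fun x => ∫ y, F y ∂(M.transitionLaw ε x) := by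
  have h : (fun x => ∫ y, F y ∂(M.transitionLaw ε x)) = fun x => ∫ ω, F (M.Tε ε ω x) ∂M.P := by
    funext x
    rw [transitionLaw, integral_map]
    · exact (hT.comp (measurable_id.prodMk measurable_const)).aemeasurable
    · exact hF.aestronglyMeasurable
  rw [h]
  exact (StronglyMeasurable.integral_prod_left' (μ := M.P)
    (f := fun q : Ω × Icc a b => F (M.Tε ε q.1 q.2)) (hF.comp hT).stronglyMeasurable).measurable

lemma isProbabilityMeasure_transitionLaw {ε : ℝ}
    (hT : Measurable fun q : Ω × Icc a b => M.Tε ε q.1 q.2) (x : Icc a b) :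
    IsProbabilityMeasure (M.transitionLaw ε x) :=
  Measure.isProbabilityMeasure_map (hT.comp (measurable_id.prodMk measurable_const)).aemeasurable

lemma integrable_of_bdd {X : Type*} [MeasurableSpace X] (ν : Measure X) [IsFiniteMeasure ν]
    {F : X → ℝ} (hF : Measurable F) {C : ℝ} (hC : ∀ x, |F x| ≤ C) : Integrable F ν :=
  Integrable.of_bound hF.aestronglyMeasurable C (ae_of_all _ hC)

lemma generator_eq {ε : ℝ} (hT : Measurable fun q : Ω × Icc a b => M.Tε ε q.1 q.2)
    {F : Icc a b → ℝ} (hF : Measurable F) {C : ℝ} (hC : ∀ x, |F x| ≤ C) (x : Icc a b) :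
    M.generator ε F x = M.β ε * (∫ y, F y ∂(M.transitionLaw ε x) - F x) := by
  have := M.isProbabilityMeasure_transitionLaw hT x
  rw [generator, integral_sub (integrable_of_bdd _ hF hC) (integrable_const _)]
  simp

lemma abs_integral_le_of_bdd {X : Type*} [MeasurableSpace X] (ν : Measure X)
    [IsProbabilityMeasure ν] {F : X → ℝ} {C : ℝ} (hC : ∀ x, |F x| ≤ C) :
    |∫ x, F x ∂ν| ≤ C := by
  have h := norm_integral_le_of_norm_le_const (μ := ν) (f := F) (C := C) (ae_of_all _ hC)
  simpa using h

/-- The resolvent equation has exactly one bounded measurable solution. -/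
theorem existsUnique_resolvent {ε lam : ℝ} (hlam : 0 < lam) (hβ : 0 < M.β ε)
    (hT : Measurable fun q : Ω × Icc a b => M.Tε ε q.1 q.2)
    (hwell : ∀ i, MeasurableSet (M.well ε i)) (g : Fin κ → ℝ) :
    ∃! F, M.IsResolventSolution ε lam g F := by
  have hprob := M.isProbabilityMeasure_transitionLaw hT
  set B := M.β ε with hB
  have hs : 0 < lam + B := by positivity
  set r : ℝ := B / (lam + B) with hr
  have hr0 : 0 ≤ r := by positivity
  have hr1 : r < 1 := by rw [hr, div_lt_one hs]; linarith
  have hGm : Measurable (M.liftWells ε g) := by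
    unfold liftWells
    exact Finset.measurable_sum _ fun i _ =>
      measurable_const.mul (measurable_one.indicator (hwell i))
  have hGb : ∀ x, |M.liftWells ε g x| ≤ ∑ i, |g i| := by
    intro x
    refine (Finset.abs_sum_le_sum_abs _ _).trans (Finset.sum_le_sum fun i _ => ?_)
    rw [abs_mul]
    refine mul_le_of_le_one_right (abs_nonneg _) ?_
    by_cases h : x ∈ M.well ε i <;> simp [h]
  set C : ℝ := (∑ i, |g i|) / (lam + B) with hC
  let A : ℕ → Icc a b → ℝ := fun n => Nat.rec (fun x => M.liftWells ε g x / (lam + B))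
    (fun _ f x => r * ∫ y, f y ∂(M.transitionLaw ε x)) n
  have hA0 : A 0 = fun x => M.liftWells ε g x / (lam + B) := rfl
  have hAs : ∀ n, A (n + 1) = fun x => r * ∫ y, A n y ∂(M.transitionLaw ε x) := fun n => rfl
  have hAm : ∀ n, Measurable (A n) := by
    intro n
    induction n with
    | zero => rw [hA0]; exact hGm.div_const _
    | succ n ih => rw [hAs]; exact (M.measurable_integral_transitionLaw hT ih).const_mul r
  have hAb : ∀ n x, |A n x| ≤ C * r ^ n := by
    intro n
    induction n with
    | zero =>
      intro x
      rw [hA0, abs_div, abs_of_pos hs, pow_zero, mul_one]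
      exact div_le_div_of_nonneg_right (hGb x) hs.le
    | succ n ih =>
      intro x
      rw [hAs, abs_mul, abs_of_nonneg hr0, pow_succ]
      have := abs_integral_le_of_bdd (M.transitionLaw ε x) ih
      nlinarith
  have hsum : Summable fun n => C * r ^ n := (summable_geometric_of_lt_one hr0 hr1).mul_left C
  have hAsum : ∀ x, Summable fun n => A n x := fun x =>
    Summable.of_norm_bounded hsum fun n => hAb n x
  let F : Icc a b → ℝ := fun x => ∑' n, A n x
  have hFm : Measurable F := by
    refine measurable_of_tendsto_metrizable
      (f := fun (N : ℕ) (x : Icc a b) => ∑ n ∈ Finset.range N, A n x) ?_ ?_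
    · intro N
      exact Finset.measurable_sum _ fun n _ => hAm n
    · rw [tendsto_pi_nhds]
      intro x
      exact (hAsum x).hasSum.tendsto_sum_nat
  have hFb : ∀ x, |F x| ≤ ∑' n, C * r ^ n := fun x =>
    tsum_of_norm_bounded (f := fun n => A n x) hsum.hasSum fun n => hAb n x
  have hFe : ∀ x, lam * F x - M.generator ε F x = M.liftWells ε g x := by
    intro x
    rw [M.generator_eq hT hFm hFb x]
    have hint : HasSum (fun n => ∫ y, A n y ∂(M.transitionLaw ε x))
        (∫ y, F y ∂(M.transitionLaw ε x)) := by
      refine hasSum_integral_of_summable_integral_norm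
        (fun n => integrable_of_bdd _ (hAm n) (hAb n)) ?_
      refine Summable.of_nonneg_of_le (fun n => integral_nonneg fun y => norm_nonneg _)
        (fun n => ?_) hsum
      exact (le_abs_self _).trans (abs_integral_le_of_bdd _ fun y => by
        rw [Real.norm_eq_abs, abs_abs]; exact hAb n y)
    have h1 : F x = A 0 x + r * ∫ y, F y ∂(M.transitionLaw ε x) := by
      have h2 : F x = A 0 x + ∑' n, A (n + 1) x := (hAsum x).tsum_eq_zero_add
      rw [h2]
      congr 1
      simp only [hAs]
      rw [tsum_mul_left, hint.tsum_eq]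
    have h3 : (lam + B) * F x = M.liftWells ε g x + B * ∫ y, F y ∂(M.transitionLaw ε x) := by
      rw [h1, hA0, hr]
      field_simp
    linarith
  refine ⟨F, ⟨hFm, ⟨_, hFb⟩, hFe⟩, ?_⟩
  · rintro F' ⟨hF'm, ⟨C', hF'b⟩, hF'e⟩
    set K := ∑' n, C * r ^ n
    have hDb : ∀ n x, |F' x - F x| ≤ (C' + K) * r ^ n := by
      intro n
      induction n with
      | zero =>
        intro x
        rw [pow_zero, mul_one]
        exact (abs_sub _ _).trans (add_le_add (hF'b x) (hFb x))
      | succ n ih =>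
        intro x
        have e1 := hF'e x
        rw [M.generator_eq hT hF'm hF'b x] at e1
        have e2 := hFe x
        rw [M.generator_eq hT hFm hFb x] at e2
        have e3 : F' x - F x = r * ∫ y, (F' y - F y) ∂(M.transitionLaw ε x) := by
          rw [integral_sub (integrable_of_bdd _ hF'm hF'b) (integrable_of_bdd _ hFm hFb), hr,
            div_mul_eq_mul_div, eq_div_iff hs.ne']
          linarith
        rw [e3, abs_mul, abs_of_nonneg hr0, pow_succ]
        have := abs_integral_le_of_bdd (M.transitionLaw ε x) ih
        nlinarith
    funext x
    have hlim : Tendsto (fun n => (C' + K) * r ^ n) atTop (𝓝 0) := by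
      simpa using (tendsto_pow_atTop_nhds_zero_of_lt_one hr0 hr1).const_mul (C' + K)
    have := ge_of_tendsto' hlim fun n => hDb n x
    linarith [abs_nonpos_iff.mp this]

lemma measurableSet_well {ε : ℝ} (hε : 0 < ε) (hMap : M.MapAssumptions)
    (hHoles : M.HoleAssumptions) (i : Fin κ) : MeasurableSet (M.well ε i) := by
  refine MeasurableSet.diff ?_ ?_
  · obtain ⟨k, l, r, -, hsub, hfin, -⟩ := hMap.decomp i
    rw [← union_sdiff_cancel (iUnion_subset hsub)]
    exact (MeasurableSet.iUnion fun m => measurableSet_Ioo).union hfin.measurableSet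
  · refine MeasurableSet.biUnion (to_countable _) fun j hj => ?_
    rcases hHoles.choice ε hε i j (Ne.symm hj) with ⟨-, -, -, J, hJ, hJo, hJe⟩ | h
    · rw [hJe]
      exact MeasurableSet.sUnion hJ.countable fun s hs => (hJo s hs).measurableSet
    · simp [hole, h]

/-- Under the assumptions above, `F_ε` is the unique bounded measurable solution of the resolvent
equation. -/
theorem resolvent_spec {ε lam : ℝ} (hε : 0 < ε) (hlam : 0 < lam) (hMap : M.MapAssumptions)
    (hNoise : M.NoiseAssumptions) (hHoles : M.HoleAssumptions) (hβ : M.TimeScale)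
    (g : Fin κ → ℝ) :
    M.IsResolventSolution ε lam g (M.resolvent ε lam g) ∧
      ∀ F, M.IsResolventSolution ε lam g F → F = M.resolvent ε lam g := by
  have h := M.existsUnique_resolvent hlam (hβ.pos ε hε) (hNoise.measurable ε hε)
    (M.measurableSet_well hε hMap hHoles) g
  have h1 := Classical.epsilon_spec h.exists
  exact ⟨h1, fun F hF => h.unique hF h1⟩

end existence

/-- The averages `f_ε(i)` of the solution of the resolvent equation. -/
def average (ε lam : ℝ) (g : Fin κ → ℝ) (i : Fin κ) : ℝ :=
  ((M.μ ε).real (M.well ε i))⁻¹ * ∫ x in M.well ε i, M.resolvent ε lam g x ∂(M.μ ε)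

/-- The generator `𝓛` on functions on the finite index set with jump rates `θ` (the values of `θ`
on the diagonal are irrelevant). -/
def limitGenerator (θ : Fin κ → Fin κ → ℝ) (f : Fin κ → ℝ) (i : Fin κ) : ℝ :=
  ∑ j, θ i j * (f j - f i)

/-- `f` is the unique solution of the reduced resolvent equation `(λ - 𝓛) f = g`. -/
def IsReducedSolution (θ : Fin κ → Fin κ → ℝ) (lam : ℝ) (g f : Fin κ → ℝ) : Prop :=
  (∀ i, lam * f i - limitGenerator θ f i = g i) ∧
    ∀ f' : Fin κ → ℝ, (∀ i, lam * f' i - limitGenerator θ f' i = g i) → f' = f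

/-- The solution of the resolvent equation with parameters `λ, g` is asymptotically constant on
each well. -/
def CondR1 (lam : ℝ) (g : Fin κ → ℝ) : Prop :=
  ∀ i, Tendsto (fun ε => ⨆ x ∈ M.well ε i, ⨆ y ∈ M.well ε i,
    ENNReal.ofReal |M.resolvent ε lam g x - M.resolvent ε lam g y|) (𝓝[>] 0) (𝓝 0)

/-- The averages of the solution of the resolvent equation with parameters `λ, g` converge to the
unique solution of the reduced resolvent equation. -/
def CondR2 (θ : Fin κ → Fin κ → ℝ) (lam : ℝ) (g : Fin κ → ℝ) : Prop :=
  ∃ f, IsReducedSolution θ lam g f ∧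
    ∀ i, Tendsto (fun ε => M.average ε lam g i) (𝓝[>] 0) (𝓝 (f i))

/-- The solution of the resolvent equation with parameters `λ, g` converges, uniformly on each
well, to the value there of the unique solution of the reduced resolvent equation. -/
def CondR (θ : Fin κ → Fin κ → ℝ) (lam : ℝ) (g : Fin κ → ℝ) : Prop :=
  ∃ f, IsReducedSolution θ lam g f ∧
    ∀ i, Tendsto (fun ε => ⨆ x ∈ M.well ε i, ENNReal.ofReal |M.resolvent ε lam g x - f i|)
      (𝓝[>] 0) (𝓝 0)

end PerturbedMap

end

/-!
The proof compares `F_ε` with the reduced equation through the trace of the chain on the union `V`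
of the wells. Write `D` for the complement of `V`, `K` for the transition kernel and `E_i` for the
wells.

For each `i` let `N_i` (`returnMeasure`, `wellReturn`) be the sum over `n ≥ 1` of the laws of `X_n`
on the event that `X_1, …, X_{n-1}` lie in `D`, for the chain started from `μ_ε` restricted to
`E_i`. On `V` it is the law of the first return to `V`, on `D` it is an occupation measure, and it
satisfies `N_i = (μ_ε|E_i + N_i|D) K` (`returnMeasure_eq_comp`). Invariance of `μ_ε` yields
`∑ N_i ≤ μ_ε` (`returnMeasure_le`). Hence the return to `V` is almost sure, so `N_i(V) = μ_ε(E_i)`,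
and comparing total masses `∑ N_i = μ_ε` on `V` (`sum_wellReturn_well`, `sum_wellReturn_restrict`).
No ergodicity or reversibility is needed.

Integrating `(λ - 𝓛_ε) F_ε = G` against `μ_ε|E_i + N_i|D` gives
`λ ∫_{E_i} F_ε dμ_ε - g(i) μ_ε(E_i) = β_ε (∫_V F_ε dN_i - ∫_{E_i} F_ε dμ_ε) - λ ∫_D F_ε dN_i`.
The last term is at most `‖g‖₁ μ_ε(D)`, and `μ_ε(D) ≤ μ_ε(Δ^ε)` because the components cover the
interval up to finitely many points. In the first term `∫_{E_i} F_ε dμ_ε = ∑_k ∫_{E_i} F_ε dN_k`,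
so that the transitions from `E_i` to itself cancel exactly, before the multiplication by the
diverging `β_ε`; in what remains `F_ε` may be replaced by its averages, at the cost of its
oscillation times the rates (`abs_reduced_equation_le`).

The jump rates that appear are `β_ε N_i(E_j) / μ_ε(E_i)`. They are the `θ_ε(i, j)`
(`setIntegral_hitProb`): from a point of `E_i` the process attains `E_j` before the return to any
other well precisely when the chain returns to `V` in `E_j` (`hit_lt_hitPlus_iff`). This holds off
the null set where some waiting time is not positive or the first jump does not move the process.

The averages `f_ε` thus solve the equation with rates `θ_ε` up to a vanishing error
(`abs_average_equation_le`), and the maximum principle (`abs_le_of_abs_resolvent_le`) turns this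
into the convergence of `f_ε` to the solution of the reduced equation (`tendsto_average`).
-/

noncomputable section

open PerturbedMap (integrable_of_bdd abs_integral_le_of_bdd)

/-! ### Return measures of a Markov chain -/

section ReturnMeasure

variable {X : Type*} [MeasurableSpace X]

/-- For a chain with transition kernel `K` and initial law `ρ`, the law of the position at time
`n + 1` restricted to the event that the chain is in `D` at the times `1, …, n`. -/
def excursion (K : Kernel X X) (D : Set X) (ρ : Measure X) : ℕ → Measure X
  | 0 => K ∘ₘ ρ
  | n + 1 => K ∘ₘ ((excursion K D ρ n).restrict D)

/-- The sum over `n ≥ 1` of the laws of the position at time `n` on the event that the chain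
has stayed in `D` at the times `1, …, n - 1`. Its restriction to the complement of `D` is the law
of the position at the first return to that complement; its restriction to `D` is the expected
occupation measure of `D` before that return. -/
def returnMeasure (K : Kernel X X) (D : Set X) (ρ : Measure X) : Measure X :=
  Measure.sum (excursion K D ρ)

variable (K : Kernel X X) {D : Set X} {ρ : Measure X}

lemma excursion_succ_eq (n : ℕ) :
    excursion K D ρ (n + 1) = excursion K D ((K ∘ₘ ρ).restrict D) n := by
  induction n with
  | zero => rfl
  | succ n ih => rw [excursion, ih]; rfl

lemma comp_restrict_returnMeasure (hD : MeasurableSet D) :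
    K ∘ₘ ((returnMeasure K D ρ).restrict D) = Measure.sum fun n => excursion K D ρ (n + 1) := by
  rw [returnMeasure, Measure.restrict_sum _ hD, Measure.bind_sum _ _ K.aemeasurable]
  simp only [excursion]

/-- The first-step decomposition of the return measure. -/
lemma returnMeasure_eq_comp (hD : MeasurableSet D) :
    returnMeasure K D ρ = K ∘ₘ (ρ + (returnMeasure K D ρ).restrict D) := by
  rw [Measure.comp_add, comp_restrict_returnMeasure K hD]
  refine Measure.ext fun A hA => ?_
  have h : (returnMeasure K D ρ) A = ∑' n, excursion K D ρ n A := Measure.sum_apply _ hA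
  have h2 : ∑' n, excursion K D ρ n A
      = excursion K D ρ 0 A + ∑' n, excursion K D ρ (n + 1) A :=
    tsum_eq_zero_add' ENNReal.summable
  rw [h, Measure.add_apply, Measure.sum_apply _ hA, h2, excursion]

lemma excursion_sum {ι : Type*} (hD : MeasurableSet D) (ρ : ι → Measure X) (n : ℕ) :
    excursion K D (Measure.sum ρ) n = Measure.sum fun i => excursion K D (ρ i) n := by
  induction n with
  | zero => exact Measure.bind_sum _ _ K.aemeasurable
  | succ n ih =>
    rw [excursion, ih, Measure.restrict_sum _ hD, Measure.bind_sum _ _ K.aemeasurable]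
    rfl

lemma returnMeasure_sum {ι : Type*} (hD : MeasurableSet D) (ρ : ι → Measure X) :
    returnMeasure K D (Measure.sum ρ) = Measure.sum fun i => returnMeasure K D (ρ i) := by
  simp only [returnMeasure]
  rw [Measure.sum_comm]
  congr 1
  funext n
  exact excursion_sum K hD ρ n

lemma comp_mono {ρ ρ' : Measure X} (h : ρ ≤ ρ') : K ∘ₘ ρ ≤ K ∘ₘ ρ' := by
  refine Measure.le_iff.mpr fun A hA => ?_
  rw [Measure.bind_apply hA K.aemeasurable, Measure.bind_apply hA K.aemeasurable]
  exact lintegral_mono' h le_rfl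

lemma comp_univ [IsMarkovKernel K] (ρ : Measure X) : (K ∘ₘ ρ) univ = ρ univ := by
  rw [Measure.bind_apply .univ K.aemeasurable]
  simp

/-- The return measure of the invariant measure restricted to the complement of `D` is bounded by
the invariant measure: the `n`-th excursion measure is the part of the stationary law on which the
last previous visit to the complement of `D` took place exactly `n + 1` steps ago. -/
lemma returnMeasure_le {μ : Measure X} (hμ : K ∘ₘ μ = μ) (hD : MeasurableSet D) :
    returnMeasure K D (μ.restrict Dᶜ) ≤ μ := by
  have key : ∀ n, ∑ k ∈ Finset.range n, excursion K D (μ.restrict Dᶜ) k ≤ μ := by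
    intro n
    induction n with
    | zero => simpa using Measure.zero_le μ
    | succ n ih =>
      have h : ∑ k ∈ Finset.range (n + 1), excursion K D (μ.restrict Dᶜ) k
          = K ∘ₘ (μ.restrict Dᶜ
            + (∑ k ∈ Finset.range n, excursion K D (μ.restrict Dᶜ) k).restrict D) := by
        rw [Finset.sum_range_succ', Measure.comp_add, add_comm]
        congr 1
        clear ih
        induction n with
        | zero => simp
        | succ n ihn =>
          rw [Finset.sum_range_succ, ihn, Finset.sum_range_succ, Measure.restrict_add,
            Measure.comp_add]
          rfl
      rw [h]
      refine (comp_mono K ?_).trans hμ.le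
      calc _ ≤ μ.restrict Dᶜ + μ.restrict D := by
            gcongr
        _ = μ := Measure.restrict_compl_add_restrict hD
  refine Measure.le_iff.mpr fun A hA => ?_
  rw [returnMeasure, Measure.sum_apply _ hA]
  refine ENNReal.tsum_le_of_sum_range_le fun n => ?_
  have := key n A
  rwa [Measure.finsetSum_apply] at this

/-- If the expected time spent in `D` is finite, the chain returns to the complement of `D`. -/
lemma returnMeasure_compl [IsMarkovKernel K] (hD : MeasurableSet D)
    (hfin : returnMeasure K D ρ D ≠ ∞) : returnMeasure K D ρ Dᶜ = ρ univ := by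
  have h : returnMeasure K D ρ univ = ρ univ + returnMeasure K D ρ D := by
    conv_lhs => rw [returnMeasure_eq_comp K hD, comp_univ]
    simp
  rw [← measure_add_measure_compl hD, add_comm] at h
  exact (ENNReal.add_left_inj hfin).mp h

/-- The trace of the chain on the complement of `D` leaves the restriction of the invariant measure
invariant. -/
lemma returnMeasure_restrict_compl [IsMarkovKernel K] {μ : Measure X} [IsFiniteMeasure μ]
    (hμ : K ∘ₘ μ = μ) (hD : MeasurableSet D) :
    (returnMeasure K D (μ.restrict Dᶜ)).restrict Dᶜ = μ.restrict Dᶜ := by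
  have hle := returnMeasure_le K hμ hD
  have : IsFiniteMeasure (returnMeasure K D (μ.restrict Dᶜ)) := isFiniteMeasure_of_le μ hle
  refine Measure.eq_of_le_of_measure_univ_eq (Measure.restrict_mono_measure hle _) ?_
  rw [Measure.restrict_apply_univ, returnMeasure_compl K hD (measure_ne_top _ _)]

lemma integral_comp_measure {ρ : Measure X} [IsMarkovKernel K] {F : X → ℝ}
    (hF : Integrable F (K ∘ₘ ρ)) : ∫ x, F x ∂(K ∘ₘ ρ) = ∫ x, ∫ y, F y ∂(K x) ∂ρ := by
  rw [Measure.comp_eq_comp_const_apply] at hF ⊢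
  rw [Kernel.integral_comp hF]
  simp

end ReturnMeasure

section Wells

variable {X ι : Type*} [MeasurableSpace X] [Countable ι] (K : Kernel X X)
  {μ : Measure X} {E : ι → Set X}

/-- The return measure to the union of the sets `E i` for the chain started from the restriction
of `μ` to the `i`-th of them. -/
def wellReturn (K : Kernel X X) (μ : Measure X) (E : ι → Set X) (i : ι) : Measure X :=
  returnMeasure K (⋃ k, E k)ᶜ (μ.restrict (E i))

lemma sum_wellReturn (hE : ∀ i, MeasurableSet (E i)) (hdisj : Pairwise (Function.onFun Disjoint E)) :
    Measure.sum (wellReturn K μ E) = returnMeasure K (⋃ k, E k)ᶜ (μ.restrict (⋃ k, E k)) := by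
  rw [Measure.restrict_iUnion hdisj hE, returnMeasure_sum K (MeasurableSet.iUnion hE).compl]
  rfl

lemma wellReturn_le (hE : ∀ i, MeasurableSet (E i)) (hdisj : Pairwise (Function.onFun Disjoint E))
    (hμ : K ∘ₘ μ = μ) (i : ι) : wellReturn K μ E i ≤ μ := by
  refine (Measure.le_sum _ i).trans ?_
  rw [sum_wellReturn K hE hdisj]
  simpa using returnMeasure_le K hμ (MeasurableSet.iUnion hE).compl

variable [IsFiniteMeasure μ]

lemma isFiniteMeasure_wellReturn (hE : ∀ i, MeasurableSet (E i))
    (hdisj : Pairwise (Function.onFun Disjoint E)) (hμ : K ∘ₘ μ = μ) (i : ι) :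
    IsFiniteMeasure (wellReturn K μ E i) :=
  isFiniteMeasure_of_le μ (wellReturn_le K hE hdisj hμ i)

variable [IsMarkovKernel K]

/-- The part of the invariant measure in the `i`-th well is the superposition of the returns to it
from all the wells. -/
lemma sum_wellReturn_restrict (hE : ∀ i, MeasurableSet (E i))
    (hdisj : Pairwise (Function.onFun Disjoint E)) (hμ : K ∘ₘ μ = μ) (i : ι) :
    (Measure.sum (wellReturn K μ E)).restrict (E i) = μ.restrict (E i) := by
  have h := returnMeasure_restrict_compl K hμ (MeasurableSet.iUnion hE).compl
  rw [compl_compl, ← sum_wellReturn K hE hdisj] at h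
  have h2 := congrArg (fun m => Measure.restrict m (E i)) h
  simpa only [Measure.restrict_restrict (hE i), inter_eq_self_of_subset_left (subset_iUnion E i)]
    using h2

variable [Fintype ι]

/-- Starting from the `i`-th well, the chain returns to some well. -/
lemma sum_wellReturn_well (hE : ∀ i, MeasurableSet (E i))
    (hdisj : Pairwise (Function.onFun Disjoint E)) (hμ : K ∘ₘ μ = μ) (i : ι) :
    ∑ j, (wellReturn K μ E i).real (E j) = μ.real (E i) := by
  have := isFiniteMeasure_wellReturn K hE hdisj hμ i
  have h := returnMeasure_compl K (ρ := μ.restrict (E i)) (MeasurableSet.iUnion hE).compl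
    (measure_ne_top (wellReturn K μ E i) _)
  rw [compl_compl, Measure.restrict_apply_univ] at h
  rw [← measureReal_iUnion_fintype hdisj hE]
  exact congrArg ENNReal.toReal h

lemma sum_setIntegral_wellReturn (hE : ∀ i, MeasurableSet (E i))
    (hdisj : Pairwise (Function.onFun Disjoint E)) (hμ : K ∘ₘ μ = μ) (i : ι)
    {F : X → ℝ} (hF : Measurable F) {C : ℝ} (hC : ∀ x, |F x| ≤ C) :
    ∑ k, ∫ x in E i, F x ∂(wellReturn K μ E k) = ∫ x in E i, F x ∂μ := by
  have := isFiniteMeasure_wellReturn K hE hdisj hμ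
  rw [← sum_wellReturn_restrict K hE hdisj hμ i, Measure.restrict_sum _ (hE i),
    Measure.sum_fintype, integral_finsetSum_measure]
  intro k _
  exact integrable_of_bdd _ hF hC

/-- As many returns enter a well from the others as leave it towards the others. -/
lemma sum_wellReturn_symm [DecidableEq ι] (hE : ∀ i, MeasurableSet (E i))
    (hdisj : Pairwise (Function.onFun Disjoint E)) (hμ : K ∘ₘ μ = μ) (i : ι) :
    ∑ k ∈ Finset.univ.erase i, (wellReturn K μ E k).real (E i)
      = ∑ k ∈ Finset.univ.erase i, (wellReturn K μ E i).real (E k) := by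
  have h1 := sum_wellReturn_well K hE hdisj hμ i
  have h2 := sum_setIntegral_wellReturn K hE hdisj hμ i (F := fun _ => 1) measurable_const
    (C := 1) (by simp)
  simp only [setIntegral_const, smul_eq_mul, mul_one] at h2
  rw [← Finset.sum_erase_add _ _ (Finset.mem_univ i)] at h1 h2
  linarith

/-- A function with `λ F - β (K F - F) = G`, where `G` vanishes outside the sets `E i`, satisfies
the resolvent equation of the trace of the chain on these sets, in integrated form and up to a
term that accounts for the time spent outside them. -/
lemma setIntegral_wellReturn_resolvent (hE : ∀ i, MeasurableSet (E i))
    (hdisj : Pairwise (Function.onFun Disjoint E)) (hμ : K ∘ₘ μ = μ) (i : ι)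
    {F G : X → ℝ} (hF : Measurable F) {C : ℝ} (hC : ∀ x, |F x| ≤ C)
    {lam β gi : ℝ} (hFG : ∀ x, lam * F x - β * (∫ y, F y ∂(K x) - F x) = G x)
    (hG0 : ∀ x ∉ ⋃ k, E k, G x = 0) (hGi : ∀ x ∈ E i, G x = gi) :
    lam * ∫ x in E i, F x ∂μ - gi * μ.real (E i)
      = β * (∑ j, ∫ x in E j, F x ∂(wellReturn K μ E i) - ∫ x in E i, F x ∂μ)
        - lam * ∫ x in (⋃ k, E k)ᶜ, F x ∂(wellReturn K μ E i) := by
  have hfin := isFiniteMeasure_wellReturn K hE hdisj hμ i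
  have hU : MeasurableSet (⋃ k, E k) := MeasurableSet.iUnion hE
  set N := wellReturn K μ E i with hN
  set D := (⋃ k, E k)ᶜ with hD
  have hint : ∀ (ν : Measure X) [IsFiniteMeasure ν], Integrable F ν := fun ν _ =>
    integrable_of_bdd ν hF hC
  have hPm : Measurable fun x => ∫ y, F y ∂(K x) :=
    (hF.stronglyMeasurable.integral_kernel).measurable
  have hPint : ∀ (ν : Measure X) [IsFiniteMeasure ν], Integrable (fun x => ∫ y, F y ∂(K x)) ν :=
    fun ν _ => integrable_of_bdd ν hPm fun x => abs_integral_le_of_bdd (K x) hC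
  have hsplit : ∫ x, F x ∂N
      = ∫ x in E i, (∫ y, F y ∂(K x)) ∂μ + ∫ x in D, (∫ y, F y ∂(K x)) ∂N := by
    have hNe : N = K ∘ₘ (μ.restrict (E i) + N.restrict D) := returnMeasure_eq_comp K hU.compl
    conv_lhs => rw [hNe]
    rw [integral_comp_measure K (hint _), integral_add_measure (hPint _) (hPint _)]
  have hNU : ∫ x, F x ∂N = ∑ j, ∫ x in E j, F x ∂N + ∫ x in D, F x ∂N := by
    rw [← integral_iUnion_fintype hE hdisj fun j => (hint N).integrableOn]
    exact (integral_add_compl hU (hint N)).symm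
  have h1 : β * ∫ x in E i, (∫ y, F y ∂(K x)) ∂μ
      = (lam + β) * ∫ x in E i, F x ∂μ - gi * μ.real (E i) := by
    have e : ∫ x in E i, (β * ∫ y, F y ∂(K x)) ∂μ = ∫ x in E i, ((lam + β) * F x - gi) ∂μ :=
      setIntegral_congr_fun (hE i) fun x hx => by
        have a := hFG x; rw [hGi x hx] at a; linarith
    rw [integral_const_mul, integral_sub ((hint _).const_mul _) (integrable_const _),
      integral_const_mul] at e
    rw [e]; simp [mul_comm]
  have h2 : β * ∫ x in D, (∫ y, F y ∂(K x)) ∂N = (lam + β) * ∫ x in D, F x ∂N := by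
    rw [← integral_const_mul, ← integral_const_mul]
    refine setIntegral_congr_fun hU.compl fun x hx => ?_
    have a := hFG x; rw [hG0 x hx] at a; linarith
  have h3 := congrArg (β * ·) (hNU.symm.trans hsplit)
  simp only [mul_add] at h3
  rw [h1, h2] at h3
  linarith

lemma abs_setIntegral_sub_le {ν : Measure X} [IsFiniteMeasure ν] {A : Set X}
    {F : X → ℝ} (hF : Measurable F) {C : ℝ} (hC : ∀ x, |F x| ≤ C)
    {c δ : ℝ} (h : ∀ x ∈ A, |F x - c| ≤ δ) :
    |∫ x in A, F x ∂ν - c * ν.real A| ≤ δ * ν.real A := by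
  have e : ∫ x in A, F x ∂ν - c * ν.real A = ∫ x in A, (F x - c) ∂ν := by
    rw [integral_sub (integrable_of_bdd _ hF hC) (integrable_const _)]
    simp [mul_comm]
  rw [e]
  exact norm_setIntegral_le_of_norm_le_const (f := fun x => F x - c) (measure_lt_top ν A) h

/-- If the solution of the resolvent equation is within `δ` of constants `c j` on the sets `E j`,
these constants solve approximately the equation with the jump rates of the trace chain. The point
is that the transitions from `E i` to itself contribute nothing, because their contribution to
`∑ j, ∫_{E j} F dN_i` is cancelled by a part of `∫_{E i} F dμ = ∑ k, ∫_{E i} F dN_k`. -/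
theorem abs_reduced_equation_le [DecidableEq ι] (hE : ∀ i, MeasurableSet (E i))
    (hdisj : Pairwise (Function.onFun Disjoint E)) (hμ : K ∘ₘ μ = μ) (i : ι)
    {F G : X → ℝ} (hF : Measurable F) {C : ℝ} (hC : ∀ x, |F x| ≤ C)
    {lam β gi : ℝ} (hlam : 0 ≤ lam) (hβ : 0 ≤ β)
    (hFG : ∀ x, lam * F x - β * (∫ y, F y ∂(K x) - F x) = G x)
    (hG0 : ∀ x ∉ ⋃ k, E k, G x = 0) (hGi : ∀ x ∈ E i, G x = gi)
    {c : ι → ℝ} {δ : ℝ} (hc : ∀ j, ∀ x ∈ E j, |F x - c j| ≤ δ) :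
    |lam * ∫ x in E i, F x ∂μ - gi * μ.real (E i)
      - β * ∑ j ∈ Finset.univ.erase i, (wellReturn K μ E i).real (E j) * (c j - c i)|
    ≤ lam * (C * μ.real (⋃ k, E k)ᶜ)
      + 2 * β * δ * ∑ j ∈ Finset.univ.erase i, (wellReturn K μ E i).real (E j) := by
  have hfin := isFiniteMeasure_wellReturn K hE hdisj hμ
  have hU : MeasurableSet (⋃ k, E k) := MeasurableSet.iUnion hE
  have hres := setIntegral_wellReturn_resolvent K hE hdisj hμ i hF hC hFG hG0 hGi
  have hsum := sum_setIntegral_wellReturn K hE hdisj hμ i hF hC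
  have hsymm := sum_wellReturn_symm K hE hdisj hμ i
  rw [← Finset.sum_erase_add _ _ (Finset.mem_univ i)] at hsum
  rw [← Finset.sum_erase_add _ _ (Finset.mem_univ i), ← hsum] at hres
  set N := wellReturn K μ E with hN
  set q := ∑ j ∈ Finset.univ.erase i, (N i).real (E j) with hq
  have hD : |∫ x in (⋃ k, E k)ᶜ, F x ∂(N i)| ≤ C * μ.real (⋃ k, E k)ᶜ := by
    have hC0 : ∀ x ∈ (⋃ k, E k)ᶜ, ‖F x‖ ≤ C := fun x _ => hC x
    refine (norm_setIntegral_le_of_norm_le_const (measure_lt_top _ _) hC0).trans ?_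
    rcases isEmpty_or_nonempty X with hX | ⟨⟨x⟩⟩
    · simp [Set.eq_empty_of_isEmpty]
    · exact mul_le_mul_of_nonneg_left
        (ENNReal.toReal_mono (measure_ne_top _ _) (wellReturn_le K hE hdisj hμ i _))
        ((abs_nonneg _).trans (hC x))
  have hout : |∑ j ∈ Finset.univ.erase i, ∫ x in E j, F x ∂(N i)
      - ∑ j ∈ Finset.univ.erase i, c j * (N i).real (E j)| ≤ δ * q := by
    rw [← Finset.sum_sub_distrib, hq, Finset.mul_sum]
    exact (Finset.abs_sum_le_sum_abs _ _).trans (Finset.sum_le_sum fun j _ =>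
      abs_setIntegral_sub_le hF hC (hc j))
  have hin : |∑ k ∈ Finset.univ.erase i, ∫ x in E i, F x ∂(N k) - c i * q| ≤ δ * q := by
    rw [← hsymm, Finset.mul_sum, Finset.mul_sum, ← Finset.sum_sub_distrib]
    exact (Finset.abs_sum_le_sum_abs _ _).trans (Finset.sum_le_sum fun k _ =>
      abs_setIntegral_sub_le hF hC (hc i))
  have hrate : ∑ j ∈ Finset.univ.erase i, (N i).real (E j) * (c j - c i)
      = ∑ j ∈ Finset.univ.erase i, c j * (N i).real (E j) - c i * q := by
    rw [hq, Finset.mul_sum, ← Finset.sum_sub_distrib]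
    exact Finset.sum_congr rfl fun j _ => by ring
  rw [hsum] at hres
  rw [hres, hrate]
  set S1 := ∑ j ∈ Finset.univ.erase i, ∫ x in E j, F x ∂(N i)
  set S2 := ∑ j ∈ Finset.univ.erase i, c j * (N i).real (E j)
  set S3 := ∑ k ∈ Finset.univ.erase i, ∫ x in E i, F x ∂(N k)
  set Z := ∫ x in (⋃ k, E k)ᶜ, F x ∂(N i)
  rw [← hsum, show β * (S1 + ∫ x in E i, F x ∂(N i) - (S3 + ∫ x in E i, F x ∂(N i))) - lam * Z
    - β * (S2 - c i * q) = β * ((S1 - S2) - (S3 - c i * q)) - lam * Z by ring]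
  refine (abs_sub _ _).trans ?_
  rw [abs_mul, abs_mul, abs_of_nonneg hlam, abs_of_nonneg hβ]
  have h1 := mul_le_mul_of_nonneg_left hD hlam
  have h2 := mul_le_mul_of_nonneg_left ((abs_sub _ _).trans (add_le_add hout hin)) hβ
  linarith

end Wells

/-! ### Hitting times of jump trajectories -/

section Trajectory

open PerturbedMap

variable {w : ℕ → ℝ}

/-- The time of the `n`-th jump, given the successive waiting times. -/
def arrival (w : ℕ → ℝ) (n : ℕ) : ℝ := ∑ k ∈ Finset.range n, w k

lemma strictMono_arrival (hw : ∀ k, 0 < w k) : StrictMono (arrival w) :=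
  strictMono_nat_of_lt_succ fun n => by
    rw [arrival, arrival, Finset.sum_range_succ]
    linarith [hw n]

lemma jumpCount_arrival (hw : ∀ k, 0 < w k) (n : ℕ) : jumpCount w (arrival w n) = n := by
  have h : {k : ℕ | ∑ l ∈ Finset.range (k + 1), w l ≤ arrival w n} = Finset.range n := by
    ext k
    have := (strictMono_arrival hw).le_iff_le (a := k + 1) (b := n)
    rw [mem_ofPred_eq, Finset.coe_range, mem_Iio, ← Nat.succ_le_iff]
    exact this
  rw [jumpCount, h, ncard_coe_finset, Finset.card_range]

/-- A number of jumps equal to zero after the first jump time is the default value of an infinite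
number of jumps. -/
lemma arrival_jumpCount_le (hw : ∀ k, 0 < w k) {t : ℝ} (h1 : arrival w 1 ≤ t) :
    (∀ n, arrival w n ≤ t) ∨ jumpCount w t ≠ 0 ∧ arrival w (jumpCount w t) ≤ t := by
  by_cases hall : ∀ n, arrival w n ≤ t
  · exact Or.inl hall
  right
  push Not at hall
  have hex : ∃ n, t < arrival w (n + 1) := by
    obtain ⟨n, hn⟩ := hall
    exact ⟨n, hn.trans (strictMono_arrival hw n.lt_succ_self)⟩
  classical
  have hN := Nat.find_spec hex
  have hmin : ∀ k, k < Nat.find hex → arrival w (k + 1) ≤ t := fun k hk =>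
    not_lt.mp (Nat.find_min hex hk)
  set N := Nat.find hex with hNdef
  have hset : {k : ℕ | ∑ l ∈ Finset.range (k + 1), w l ≤ t} = Finset.range N := by
    ext k
    rw [mem_ofPred_eq, Finset.coe_range, mem_Iio]
    refine ⟨fun hk => ?_, fun hk => hmin k hk⟩
    by_contra hle
    have : arrival w (N + 1) ≤ arrival w (k + 1) :=
      (strictMono_arrival hw).monotone (by omega)
    exact absurd (hN.trans_le this) (not_lt.mpr hk)
  have hcount : jumpCount w t = N := by
    rw [jumpCount, hset, ncard_coe_finset, Finset.card_range]
  have hN0 : N ≠ 0 := by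
    rintro h0
    rw [h0] at hN
    exact absurd h1 (not_le.mpr hN)
  refine ⟨hcount ▸ hN0, ?_⟩
  rw [hcount]
  obtain ⟨m, hm⟩ := Nat.exists_eq_succ_of_ne_zero hN0
  rw [hm]
  exact hmin m (by omega)

lemma arrival_one_le (hw : ∀ k, 0 < w k) {t : ℝ} (h : jumpCount w t ≠ 0) : arrival w 1 ≤ t := by
  obtain ⟨k, hk⟩ := nonempty_of_ncard_ne_zero h
  exact ((strictMono_arrival hw).monotone (by omega : 1 ≤ k + 1)).trans hk

variable {a b : ℝ} {x : ℕ → Icc a b} {β : ℝ}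

/-- For a trajectory that visits the states `x 0, x 1, …` with positive waiting times and really
moves at its first jump, the set `A` is attained before the next visit to `B` if and only if the
first of the states `x 1, x 2, …` that lies in `A ∪ B` lies in `A`. -/
lemma hit_lt_hitPlus_iff (hw : ∀ k, 0 < w k) (hβ : 0 < β) (hx : x 1 ≠ x 0) {A B : Set (Icc a b)}
    (hAB : Disjoint A B) (h0 : x 0 ∉ A) :
    hit (fun t : ℝ≥0 => x (jumpCount w (β * t))) A
        < hitPlus (fun t : ℝ≥0 => x (jumpCount w (β * t))) B
      ↔ ∃ n, x (n + 1) ∈ A ∧ ∀ k < n, x (k + 1) ∈ (A ∪ B)ᶜ := by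
  have hmono := strictMono_arrival hw
  have hnn : ∀ n, 0 ≤ arrival w n := fun n => Finset.sum_nonneg fun k _ => (hw k).le
  set y : ℝ≥0 → Icc a b := fun t => x (jumpCount w (β * t)) with hy
  let u : ℕ → ℝ≥0 := fun n => ⟨arrival w n / β, div_nonneg (hnn n) hβ.le⟩
  have hu : ∀ n, β * (u n : ℝ) = arrival w n := fun n => mul_div_cancel₀ _ hβ.ne'
  have hule : ∀ n (t : ℝ≥0), u n ≤ t ↔ arrival w n ≤ β * t := fun n t => by
    rw [← hu, mul_le_mul_iff_right₀ hβ, NNReal.coe_le_coe]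
  have hyu : ∀ n, y (u n) = x n := fun n => by
    simp only [hy]; rw [hu, jumpCount_arrival hw]
  have humono : StrictMono u := fun m n hmn => by
    rw [← NNReal.coe_lt_coe]; exact div_lt_div_of_pos_right (hmono hmn) hβ
  have hu0 : y 0 = x 0 := by
    rw [← hyu 0]; congr 1; exact NNReal.eq (by change 0 = arrival w 0 / β; simp [arrival])
  have hfirst : firstJump y = u 1 := by
    refine le_antisymm (iInf₂_le _ (by rw [hyu, hu0]; exact hx)) (le_iInf₂ fun t ht => ?_)
    rw [ENNReal.coe_le_coe, hule]
    refine arrival_one_le hw fun h => ht ?_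
    rw [hu0]; simp only [hy]; rw [h]
  constructor
  · intro hlt
    by_contra hcon
    push Not at hcon
    refine absurd hlt (not_lt.mpr (le_iInf₂ fun t ht => ?_))
    have hj : jumpCount w (β * t) ≠ 0 := fun h => h0 (by simp only [hy] at ht; rwa [h] at ht)
    have hle : ∃ k, x (k + 1) ∈ A ∧ u (k + 1) ≤ t := by
      rcases arrival_jumpCount_le hw (arrival_one_le hw hj) with h | ⟨-, h⟩
      · obtain ⟨k, hk⟩ := Nat.exists_eq_succ_of_ne_zero hj
        exact ⟨k, by simp only [hy] at ht; rwa [hk] at ht, (hule _ _).mpr (h _)⟩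
      · obtain ⟨k, hk⟩ := Nat.exists_eq_succ_of_ne_zero hj
        rw [hk] at h
        exact ⟨k, by simp only [hy] at ht; rwa [hk] at ht, (hule _ _).mpr h⟩
    obtain ⟨k, hkA, hkt⟩ := hle
    classical
    have hex : ∃ n, x (n + 1) ∈ A ∪ B := ⟨k, Or.inl hkA⟩
    have hn := Nat.find_spec hex
    have hmin : ∀ l < Nat.find hex, x (l + 1) ∈ (A ∪ B)ᶜ := fun l hl => Nat.find_min hex hl
    have hnk : Nat.find hex ≤ k := Nat.find_min' hex (Or.inl hkA)
    have hnB : x (Nat.find hex + 1) ∈ B := hn.resolve_left fun hA => by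
      obtain ⟨l, hl, hl2⟩ := hcon _ hA
      exact hl2 (hmin l hl)
    calc hitPlus y B ≤ u (Nat.find hex + 1) := by
          refine iInf₂_le (u (Nat.find hex + 1)) ⟨?_, by rwa [hyu]⟩
          rw [hfirst, ENNReal.coe_le_coe]
          exact humono.monotone (by omega)
      _ ≤ t := by
          rw [ENNReal.coe_le_coe]
          exact (humono.monotone (by omega)).trans hkt
  · rintro ⟨n, hnA, hn⟩
    calc hit y A ≤ u (n + 1) := iInf₂_le (u (n + 1)) (by rwa [hyu])
      _ < u (n + 2) := by rw [ENNReal.coe_lt_coe]; exact humono (by omega)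
      _ ≤ hitPlus y B := by
        refine le_iInf₂ fun t ht => ?_
        obtain ⟨ht1, htB⟩ := ht
        rw [hfirst, ENNReal.coe_le_coe, hule] at ht1
        rw [ENNReal.coe_le_coe, hule]
        rcases arrival_jumpCount_le hw ht1 with h | ⟨hj, h⟩
        · exact h _
        · obtain ⟨k, hk⟩ := Nat.exists_eq_succ_of_ne_zero hj
          simp only [hy] at htB
          rw [hk] at h htB
          refine (hmono.monotone ?_).trans h
          have hkn : ¬ k < n := fun hlt => hn k hlt (Or.inr htB)
          have hne : k ≠ n := fun he => disjoint_left.mp hAB (he ▸ hnA) htB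
          omega

end Trajectory

/-! ### The Markov property -/

section Markov

/-- The sequence with first term `q.1` followed by the sequence `q.2`. -/
def consSeq {Ω : Type*} (q : Ω × (ℕ → Ω)) : ℕ → Ω
  | 0 => q.1
  | n + 1 => q.2 n

lemma measurable_consSeq {Ω : Type*} [MeasurableSpace Ω] :
    Measurable (consSeq : Ω × (ℕ → Ω) → ℕ → Ω) := by
  refine measurable_pi_lambda _ fun n => ?_
  cases n with
  | zero => exact measurable_fst
  | succ n => exact (measurable_pi_apply n).comp measurable_snd

/-- An i.i.d. sequence consists of its first term and an independent i.i.d. sequence. -/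
lemma map_consSeq_infinitePi {Ω : Type*} [MeasurableSpace Ω] (P : Measure Ω)
    [IsProbabilityMeasure P] :
    (P.prod (Measure.infinitePi fun _ : ℕ => P)).map consSeq = Measure.infinitePi fun _ => P := by
  refine Measure.eq_infinitePi _ fun s t ht => ?_
  classical
  obtain ⟨N, hN⟩ : ∃ N, s ⊆ Finset.range (N + 1) :=
    ⟨s.sup id, fun n hn => Finset.mem_range_succ_iff.mpr (Finset.le_sup (f := id) hn)⟩
  -- Coordinates outside `s` are constrained to lie in `univ`, so that `s` may be replaced by an
  -- initial segment.
  set t' : ℕ → Set Ω := fun n => if n ∈ s then t n else univ with ht'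
  have hm : ∀ n, MeasurableSet (t' n) := fun n => by
    simp only [ht']; split_ifs
    exacts [ht n, .univ]
  have hpi : Set.pi (s : Set ℕ) t = Set.pi (Finset.range (N + 1) : Finset ℕ) t' := by
    ext f
    simp only [Set.mem_pi, Finset.mem_coe, ht']
    refine ⟨fun h n _ => ?_, fun h n hn => ?_⟩
    · split_ifs with hs
      exacts [h n hs, mem_univ _]
    · simpa [hn] using h n (hN hn)
  have hpre : consSeq ⁻¹' Set.pi (Finset.range (N + 1) : Finset ℕ) t'
      = t' 0 ×ˢ Set.pi (Finset.range N : Finset ℕ) fun n => t' (n + 1) := by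
    ext q
    simp only [mem_preimage, Set.mem_pi, Finset.mem_coe, Finset.mem_range, mem_prod]
    refine ⟨fun h => ⟨h 0 (by omega), fun n hn => h (n + 1) (by omega)⟩, fun h n hn => ?_⟩
    cases n with
    | zero => exact h.1
    | succ n => exact h.2 n (by omega)
  rw [hpi, Measure.map_apply measurable_consSeq
    (MeasurableSet.pi (Finset.countable_toSet _) fun n _ => hm n), hpre, Measure.prod_prod,
    Measure.infinitePi_pi _ fun n _ => hm (n + 1)]
  have h1 : ∏ n ∈ s, P (t n) = ∏ n ∈ Finset.range (N + 1), P (t' n) := by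
    rw [← Finset.prod_subset hN fun n _ hn => by simp [ht', hn]]
    exact Finset.prod_congr rfl fun n hn => by simp [ht', hn]
  rw [h1, Finset.prod_range_succ', mul_comm]

end Markov

namespace PerturbedMap

variable {a b : ℝ} {κ : ℕ} {Ω : Type*} [MeasurableSpace Ω] (M : PerturbedMap a b κ Ω) {ε : ℝ}

lemma measurable_Tε_left (hT : Measurable fun q : Ω × Icc a b => M.Tε ε q.1 q.2) (x : Icc a b) :
    Measurable fun ω => M.Tε ε ω x :=
  hT.comp (measurable_id.prodMk measurable_const)

/-- The one-step transition probabilities as a Markov kernel. -/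
def transitionKernel (hT : Measurable fun q : Ω × Icc a b => M.Tε ε q.1 q.2) :
    Kernel (Icc a b) (Icc a b) where
  toFun := M.transitionLaw ε
  measurable' := by
    refine Measure.measurable_of_measurable_coe _ fun A hA => ?_
    have h : (fun x => M.transitionLaw ε x A)
        = fun x => M.P ((fun ω => (ω, x)) ⁻¹' ((fun q : Ω × Icc a b => M.Tε ε q.1 q.2) ⁻¹' A)) := by
      funext x
      rw [transitionLaw, Measure.map_apply (M.measurable_Tε_left hT x) hA]
      rfl
    rw [h]
    exact measurable_measure_prodMk_right (hT hA)

instance isMarkovKernel_transitionKernel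
    (hT : Measurable fun q : Ω × Icc a b => M.Tε ε q.1 q.2) :
    IsMarkovKernel (M.transitionKernel hT) :=
  ⟨M.isProbabilityMeasure_transitionLaw hT⟩

lemma measurable_chain (hT : Measurable fun q : Ω × Icc a b => M.Tε ε q.1 q.2) (n : ℕ) :
    Measurable fun q : Icc a b × (ℕ → Ω) => M.chain ε q.1 q.2 n := by
  induction n with
  | zero => exact measurable_fst
  | succ n ih => exact hT.comp (((measurable_pi_apply n).comp measurable_snd).prodMk ih)

lemma chain_consSeq (x : Icc a b) (q : Ω × (ℕ → Ω)) (n : ℕ) :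
    M.chain ε x (consSeq q) (n + 1) = M.chain ε (M.Tε ε q.1 x) q.2 n := by
  induction n with
  | zero => rfl
  | succ n ih => rw [chain, ih]; rfl

/-- The set of starting points and noises for which the chain is in `D` at the times `1, …, n` and
in `A` at time `n + 1`. -/
def returnEvent (ε : ℝ) (D A : Set (Icc a b)) (n : ℕ) : Set (Icc a b × (ℕ → Ω)) :=
  {q | M.chain ε q.1 q.2 (n + 1) ∈ A ∧ ∀ k < n, M.chain ε q.1 q.2 (k + 1) ∈ D}

lemma measurableSet_returnEvent (hT : Measurable fun q : Ω × Icc a b => M.Tε ε q.1 q.2)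
    {D A : Set (Icc a b)} (hD : MeasurableSet D) (hA : MeasurableSet A) (n : ℕ) :
    MeasurableSet (M.returnEvent ε D A n) := by
  have h : M.returnEvent ε D A n = (fun q => M.chain ε q.1 q.2 (n + 1)) ⁻¹' A ∩
      ⋂ k, ⋂ (_ : k < n), (fun q => M.chain ε q.1 q.2 (k + 1)) ⁻¹' D := by
    ext q; simp [returnEvent]
  rw [h]
  exact (M.measurable_chain hT _ hA).inter (MeasurableSet.iInter fun k =>
    MeasurableSet.iInter fun _ => M.measurable_chain hT _ hD)

/-- The Markov property at time one. -/
lemma infinitePi_returnEvent_succ (hT : Measurable fun q : Ω × Icc a b => M.Tε ε q.1 q.2)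
    {D A : Set (Icc a b)} (hD : MeasurableSet D) (hA : MeasurableSet A) (n : ℕ) (x : Icc a b) :
    Measure.infinitePi (fun _ : ℕ => M.P) (Prod.mk x ⁻¹' M.returnEvent ε D A (n + 1))
      = ∫⁻ y in D, Measure.infinitePi (fun _ : ℕ => M.P) (Prod.mk y ⁻¹' M.returnEvent ε D A n)
          ∂(M.transitionLaw ε x) := by
  have hmeas : Measurable fun y =>
      Measure.infinitePi (fun _ : ℕ => M.P) (Prod.mk y ⁻¹' M.returnEvent ε D A n) :=
    measurable_measure_prodMk_left (M.measurableSet_returnEvent hT hD hA n)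
  have hTx : Measurable fun ω => M.Tε ε ω x := hT.comp (measurable_id.prodMk measurable_const)
  have hS : MeasurableSet (Prod.mk x ⁻¹' M.returnEvent ε D A (n + 1)) :=
    measurable_prodMk_left (M.measurableSet_returnEvent hT hD hA (n + 1))
  rw [← lintegral_indicator hD, transitionLaw, lintegral_map (hmeas.indicator hD) hTx]
  conv_lhs => rw [← map_consSeq_infinitePi M.P, Measure.map_apply measurable_consSeq hS,
    Measure.prod_apply (measurable_consSeq hS)]
  refine lintegral_congr fun ω => ?_
  by_cases hω : M.Tε ε ω x ∈ D
  · rw [indicator_of_mem hω]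
    congr 1
    ext ω'
    simp only [mem_preimage, returnEvent, mem_ofPred_eq, chain_consSeq]
    refine and_congr_right fun _ => ⟨fun h k hk => h (k + 1) (by omega), fun h k hk => ?_⟩
    cases k with
    | zero => exact hω
    | succ k => exact h k (by omega)
  · rw [indicator_of_notMem hω]
    refine measure_mono_null (t := ∅) (fun ω' h => ?_) measure_empty
    have h' := h.2 0 (by omega)
    rw [chain_consSeq] at h'
    exact hω h'

lemma lintegral_returnEvent (hT : Measurable fun q : Ω × Icc a b => M.Tε ε q.1 q.2)
    {D A : Set (Icc a b)} (hD : MeasurableSet D) (hA : MeasurableSet A) (n : ℕ)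
    (ρ : Measure (Icc a b)) :
    ∫⁻ x, Measure.infinitePi (fun _ : ℕ => M.P) (Prod.mk x ⁻¹' M.returnEvent ε D A n) ∂ρ
      = excursion (M.transitionKernel hT) D ρ n A := by
  induction n generalizing ρ with
  | zero =>
    rw [excursion, Measure.bind_apply hA (Kernel.aemeasurable _)]
    refine lintegral_congr fun x => ?_
    have hset : Prod.mk x ⁻¹' M.returnEvent ε D A 0
        = (fun ω : ℕ → Ω => ω 0) ⁻¹' ((fun ω => M.Tε ε ω x) ⁻¹' A) := by
      ext ω; simp [returnEvent, chain]
    rw [hset, (measurePreserving_eval_infinitePi (fun _ : ℕ => M.P) 0).measure_preimage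
      (M.measurable_Tε_left hT x hA).nullMeasurableSet]
    exact (Measure.map_apply (M.measurable_Tε_left hT x) hA).symm
  | succ n ih =>
    rw [excursion_succ_eq, ← ih, ← lintegral_indicator hD,
      Measure.lintegral_bind (Kernel.aemeasurable _)]
    · refine lintegral_congr fun x => ?_
      rw [M.infinitePi_returnEvent_succ hT hD hA, lintegral_indicator hD]
      rfl
    · exact ((measurable_measure_prodMk_left
        (M.measurableSet_returnEvent hT hD hA n)).indicator hD).aemeasurable

/-! ### Jump rates between wells and return measures -/

lemma ae_expOne_pos : ∀ᵐ t ∂expOne, 0 < t := by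
  have h : expOne (Iic 0) = 0 := by
    have h1 := cdf_expMeasure_eq one_pos 0
    have := isProbabilityMeasure_expMeasure one_pos
    rw [cdf_eq_real (expMeasure 1)] at h1
    simpa [measureReal_eq_zero_iff, expOne] using h1
  rw [ae_iff]
  refine measure_mono_null (fun t ht => ?_) h
  exact not_lt.mp ht

lemma lebesgue_singleton (x : Icc a b) : lebesgue a b {x} = 0 := by
  rw [lebesgue, (MeasurableEmbedding.subtype_coe measurableSet_Icc).comap_apply]
  simp

/-- Almost surely, all waiting times are positive and the first jump really moves the process. -/
lemma ae_pathLaw (hT : Measurable fun q : Ω × Icc a b => M.Tε ε q.1 q.2) {x : Icc a b}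
    (hac : M.transitionLaw ε x ≪ lebesgue a b) :
    ∀ᵐ q ∂M.pathLaw, (∀ k, 0 < q.2 k) ∧ M.chain ε x q.1 1 ≠ x := by
  have h1 : ∀ᵐ w ∂(Measure.infinitePi fun _ : ℕ => expOne), ∀ k, 0 < w k := by
    rw [ae_all_iff]
    exact fun k => (measurePreserving_eval_infinitePi (fun _ : ℕ => expOne)
      k).quasiMeasurePreserving.ae ae_expOne_pos
  have h2 : ∀ᵐ ω ∂(Measure.infinitePi fun _ : ℕ => M.P), M.chain ε x ω 1 ≠ x := by
    have h3 : ∀ᵐ ω ∂M.P, M.Tε ε ω x ≠ x := by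
      refine ae_of_ae_map (f := fun ω => M.Tε ε ω x) (p := fun y => y ≠ x)
        (M.measurable_Tε_left hT x).aemeasurable ?_
      rw [ae_iff]
      simpa [transitionLaw] using hac (lebesgue_singleton x)
    exact (measurePreserving_eval_infinitePi (fun _ : ℕ => M.P) 0).quasiMeasurePreserving.ae h3
  have h4 := (measurePreserving_snd (μ := Measure.infinitePi fun _ : ℕ => M.P)
    (ν := Measure.infinitePi fun _ : ℕ => expOne)).quasiMeasurePreserving.ae h1
  have h5 := (measurePreserving_fst (μ := Measure.infinitePi fun _ : ℕ => M.P)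
    (ν := Measure.infinitePi fun _ : ℕ => expOne)).quasiMeasurePreserving.ae h2
  exact h4.and h5

lemma disjoint_well (hMap : M.MapAssumptions) :
    Pairwise (Function.onFun Disjoint (M.well ε)) := fun _ _ hij =>
  (hMap.disjoint hij).mono sdiff_subset sdiff_subset

lemma well_union_otherWells (j : Fin κ) : M.well ε j ∪ M.otherWells ε j = ⋃ i, M.well ε i := by
  ext x
  simp only [otherWells, mem_union, mem_iUnion, exists_prop, mem_ofPred_eq]
  refine ⟨?_, fun ⟨i, hi⟩ => ?_⟩
  · rintro (h | ⟨i, -, h⟩)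
    exacts [⟨j, h⟩, ⟨i, h⟩]
  · by_cases hij : i = j
    exacts [Or.inl (hij ▸ hi), Or.inr ⟨i, hij, hi⟩]

/-- Starting in another well, the `j`-th well is attained before the return to any other one if and
only if the chain makes its first return to the union of the wells in the `j`-th well. -/
lemma hitProb_eq (hT : Measurable fun q : Ω × Icc a b => M.Tε ε q.1 q.2)
    (hMap : M.MapAssumptions) (hwell : ∀ i, MeasurableSet (M.well ε i)) (hβ : 0 < M.β ε)
    {x : Icc a b} (hac : M.transitionLaw ε x ≪ lebesgue a b) {j : Fin κ} (hx : x ∉ M.well ε j) :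
    M.hitProb ε j x = (∑' n, Measure.infinitePi (fun _ : ℕ => M.P)
      (Prod.mk x ⁻¹' M.returnEvent ε (⋃ i, M.well ε i)ᶜ (M.well ε j) n)).toReal := by
  have hU : MeasurableSet (⋃ i, M.well ε i) := MeasurableSet.iUnion hwell
  have hmeas : ∀ n, MeasurableSet
      (Prod.mk x ⁻¹' M.returnEvent ε (⋃ i, M.well ε i)ᶜ (M.well ε j) n) := fun n =>
    measurable_prodMk_left (M.measurableSet_returnEvent hT hU.compl (hwell j) n)
  have hdisj : Pairwise (Function.onFun Disjoint fun n =>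
      Prod.mk x ⁻¹' M.returnEvent ε (⋃ i, M.well ε i)ᶜ (M.well ε j) n) := by
    refine (pairwise_disjoint_on _).mpr fun m n hmn => disjoint_left.mpr fun ω hm hn => ?_
    exact hn.2 m hmn (mem_iUnion.mpr ⟨j, hm.1⟩)
  have hother : Disjoint (M.well ε j) (M.otherWells ε j) := by
    refine disjoint_left.mpr fun y hy hy' => ?_
    simp only [otherWells, mem_iUnion, exists_prop, mem_ofPred_eq] at hy'
    obtain ⟨i, hij, hi⟩ := hy'
    exact disjoint_left.mp (M.disjoint_well hMap hij) hi hy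
  have hae : {q | hit (M.ξ ε x q) (M.well ε j) < hitPlus (M.ξ ε x q) (M.otherWells ε j)}
      =ᵐ[M.pathLaw] Prod.fst ⁻¹' ⋃ n,
        Prod.mk x ⁻¹' M.returnEvent ε (⋃ i, M.well ε i)ᶜ (M.well ε j) n := by
    rw [eventuallyEq_set]
    filter_upwards [M.ae_pathLaw hT hac] with q hq
    refine (hit_lt_hitPlus_iff (x := M.chain ε x q.1) hq.1 hβ hq.2 hother hx).trans ?_
    rw [M.well_union_otherWells, mem_preimage, mem_iUnion]
    rfl
  rw [hitProb, measureReal_def, measure_congr hae, pathLaw,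
    measurePreserving_fst.measure_preimage (MeasurableSet.iUnion hmeas).nullMeasurableSet,
    measure_iUnion hdisj hmeas]

/-- The numerator of the rate `θ_ε(i, j)` is the mass in the `j`-th well of the return measure
from the `i`-th well. -/
theorem setIntegral_hitProb (hT : Measurable fun q : Ω × Icc a b => M.Tε ε q.1 q.2)
    (hMap : M.MapAssumptions) (hwell : ∀ i, MeasurableSet (M.well ε i)) (hβ : 0 < M.β ε)
    (hac : ∀ x, M.transitionLaw ε x ≪ lebesgue a b) {i j : Fin κ} (hij : i ≠ j)
    (hfin : wellReturn (M.transitionKernel hT) (M.μ ε) (M.well ε) i (M.well ε j) ≠ ∞) :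
    ∫ x in M.well ε i, M.hitProb ε j x ∂(M.μ ε)
      = (wellReturn (M.transitionKernel hT) (M.μ ε) (M.well ε) i).real (M.well ε j) := by
  have hU : MeasurableSet (⋃ i, M.well ε i) := MeasurableSet.iUnion hwell
  have hmeas : ∀ n, Measurable fun x => Measure.infinitePi (fun _ : ℕ => M.P)
      (Prod.mk x ⁻¹' M.returnEvent ε (⋃ i, M.well ε i)ᶜ (M.well ε j) n) := fun n =>
    measurable_measure_prodMk_left (M.measurableSet_returnEvent hT hU.compl (hwell j) n)
  have hlint : ∫⁻ x in M.well ε i, ∑' n, Measure.infinitePi (fun _ : ℕ => M.P)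
      (Prod.mk x ⁻¹' M.returnEvent ε (⋃ i, M.well ε i)ᶜ (M.well ε j) n) ∂(M.μ ε)
      = wellReturn (M.transitionKernel hT) (M.μ ε) (M.well ε) i (M.well ε j) := by
    rw [lintegral_tsum fun n => (hmeas n).aemeasurable, wellReturn, returnMeasure,
      Measure.sum_apply _ (hwell j)]
    exact tsum_congr fun n => M.lintegral_returnEvent hT hU.compl (hwell j) n _
  rw [setIntegral_congr_fun (hwell i) fun x hx => M.hitProb_eq hT hMap hwell hβ (hac x)
    (disjoint_left.mp (M.disjoint_well hMap hij) hx), integral_toReal, hlint, measureReal_def]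
  · exact (Measurable.tsum hmeas).aemeasurable
  · exact ae_lt_top (Measurable.tsum hmeas) (hlint ▸ hfin)

end PerturbedMap

/-! ### The reduced resolvent equation -/

namespace PerturbedMap

section Reduced

variable {κ : ℕ} {θ : Fin κ → Fin κ → ℝ} {lam : ℝ}

lemma limitGenerator_sub (θ : Fin κ → Fin κ → ℝ) (u v : Fin κ → ℝ) (i : Fin κ) :
    limitGenerator θ (fun j => u j - v j) i = limitGenerator θ u i - limitGenerator θ v i := by
  simp only [limitGenerator]
  rw [← Finset.sum_sub_distrib]
  exact Finset.sum_congr rfl fun j _ => by ring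

lemma limitGenerator_eq_sum_erase (θ : Fin κ → Fin κ → ℝ) (u : Fin κ → ℝ) (i : Fin κ) :
    limitGenerator θ u i = ∑ j ∈ Finset.univ.erase i, θ i j * (u j - u i) := by
  rw [limitGenerator, ← Finset.sum_erase_add _ _ (Finset.mem_univ i)]
  simp

lemma le_of_resolvent_le (hθ : ∀ i j, i ≠ j → 0 ≤ θ i j) (hlam : 0 < lam) {u : Fin κ → ℝ} {η : ℝ}
    (h : ∀ i, lam * u i - limitGenerator θ u i ≤ η) (i : Fin κ) : u i ≤ η / lam := by
  obtain ⟨k, -, hk⟩ := Finset.exists_max_image Finset.univ u ⟨i, Finset.mem_univ i⟩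
  have h1 : limitGenerator θ u k ≤ 0 := by
    rw [limitGenerator_eq_sum_erase]
    refine Finset.sum_nonpos fun j hj => mul_nonpos_of_nonneg_of_nonpos
      (hθ k j (Finset.ne_of_mem_erase hj).symm) (sub_nonpos.mpr (hk j (Finset.mem_univ j)))
  refine (hk i (Finset.mem_univ i)).trans ((le_div_iff₀ hlam).mpr ?_)
  linarith [h k]

/-- The maximum principle for the reduced resolvent equation. -/
lemma abs_le_of_abs_resolvent_le (hθ : ∀ i j, i ≠ j → 0 ≤ θ i j) (hlam : 0 < lam)
    {u : Fin κ → ℝ} {η : ℝ} (h : ∀ i, |lam * u i - limitGenerator θ u i| ≤ η) (i : Fin κ) :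
    |u i| ≤ η / lam := by
  refine abs_le'.mpr ⟨le_of_resolvent_le hθ hlam (fun i => (le_abs_self _).trans (h i)) i, ?_⟩
  refine le_of_resolvent_le (u := fun i => - u i) hθ hlam (fun i => ?_) i
  have e : limitGenerator θ (fun i => - u i) i = - limitGenerator θ u i := by
    simp only [limitGenerator]
    rw [← Finset.sum_neg_distrib]
    exact Finset.sum_congr rfl fun j _ => by ring
  rw [e]
  linarith [(neg_le_abs _).trans (h i)]

lemma exists_isReducedSolution (hθ : ∀ i j, i ≠ j → 0 ≤ θ i j) (hlam : 0 < lam) (g : Fin κ → ℝ) :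
    ∃ f, IsReducedSolution θ lam g f := by
  let A : (Fin κ → ℝ) →ₗ[ℝ] (Fin κ → ℝ) :=
    { toFun := fun f i => lam * f i - limitGenerator θ f i
      map_add' := fun u v => by
        funext i
        simp only [limitGenerator, Pi.add_apply]
        rw [show ∑ j, θ i j * (u j + v j - (u i + v i))
          = ∑ j, θ i j * (u j - u i) + ∑ j, θ i j * (v j - v i) by
            rw [← Finset.sum_add_distrib]; exact Finset.sum_congr rfl fun j _ => by ring]
        ring
      map_smul' := fun c u => by
        funext i
        simp only [limitGenerator, Pi.smul_apply, smul_eq_mul, RingHom.id_apply]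
        rw [show ∑ j, θ i j * (c * u j - c * u i) = c * ∑ j, θ i j * (u j - u i) by
            rw [Finset.mul_sum]; exact Finset.sum_congr rfl fun j _ => by ring]
        ring }
  have hinj : Function.Injective A := by
    refine (injective_iff_map_eq_zero A).mpr fun u hu => funext fun i => ?_
    have := abs_le_of_abs_resolvent_le hθ hlam (u := u) (η := 0) (fun k => by
      have : lam * u k - limitGenerator θ u k = 0 := congrFun hu k
      rw [this, abs_zero]) i
    rw [zero_div] at this
    exact abs_nonpos_iff.mp this
  obtain ⟨f, hf⟩ := LinearMap.injective_iff_surjective.mp hinj g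
  exact ⟨f, fun i => congrFun hf i, fun f' hf' => hinj ((funext hf').trans hf.symm)⟩

end Reduced

/-! ### The wells for a fixed noise level -/

variable {a b : ℝ} {κ : ℕ} {Ω : Type*} [MeasurableSpace Ω] (M : PerturbedMap a b κ Ω) {ε : ℝ}

lemma finite_compl_iUnion_comp (hMap : M.MapAssumptions) : (⋃ i, M.comp i)ᶜ.Finite := by
  choose k l r hlr hsub hfin _ using hMap.decomp
  set Z : Set (Icc a b) := (⋃ i, (M.comp i \ ⋃ m, Ioo (l i m) (r i m)))
    ∪ ⋃ i, ⋃ m, {l i m, r i m} with hZ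
  have hZfin : Z.Finite :=
    (finite_iUnion hfin).union (finite_iUnion fun i => finite_iUnion fun m => by simp)
  refine hZfin.subset fun x hx => ?_
  have hcl : IsClosed (Z ∪ ⋃ i, ⋃ m, Icc (l i m) (r i m)) :=
    hZfin.isClosed.union (isClosed_iUnion_of_finite fun i => isClosed_iUnion_of_finite fun m =>
      isClosed_Icc)
  have hsubset : ⋃ i, M.comp i ⊆ Z ∪ ⋃ i, ⋃ m, Icc (l i m) (r i m) := by
    refine iUnion_subset fun i y hy => ?_
    by_cases h : y ∈ ⋃ m, Ioo (l i m) (r i m)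
    · obtain ⟨m, hm⟩ := mem_iUnion.mp h
      exact Or.inr (mem_iUnion₂.mpr ⟨i, m, Ioo_subset_Icc_self hm⟩)
    · exact Or.inl (Or.inl (mem_iUnion.mpr ⟨i, hy, h⟩))
  have hxmem := closure_minimal hsubset hcl (hMap.cover ▸ mem_univ x)
  rcases hxmem with h | h
  · exact h
  obtain ⟨i, m, hm⟩ := mem_iUnion₂.mp h
  refine Or.inr (mem_iUnion₂.mpr ⟨i, m, ?_⟩)
  by_contra hne
  simp only [mem_insert_iff, mem_singleton_iff, not_or] at hne
  exact hx (mem_iUnion.mpr ⟨i, hsub i m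
    ⟨lt_of_le_of_ne hm.1 (Ne.symm hne.1), lt_of_le_of_ne hm.2 hne.2⟩⟩)

lemma measure_compl_wells_le (hMap : M.MapAssumptions) (hac : M.μ ε ≪ lebesgue a b) :
    M.μ ε (⋃ i, M.well ε i)ᶜ ≤ M.μ ε (M.holes ε) := by
  have hnull : M.μ ε (⋃ i, M.comp i)ᶜ = 0 := by
    rw [← biUnion_of_singleton (⋃ i, M.comp i)ᶜ]
    exact (measure_biUnion_null_iff (M.finite_compl_iUnion_comp hMap).countable).mpr
      fun x _ => hac (lebesgue_singleton x)
  have hsub : (⋃ i, M.well ε i)ᶜ ⊆ M.holes ε ∪ (⋃ i, M.comp i)ᶜ := by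
    intro x hx
    by_cases h : x ∈ ⋃ i, M.comp i
    · obtain ⟨i, hi⟩ := mem_iUnion.mp h
      by_contra hcon
      exact hx (mem_iUnion.mpr ⟨i, hi, fun hh => hcon (Or.inl (mem_iUnion.mpr ⟨i, hh⟩))⟩)
    · exact Or.inr h
  exact (measure_mono hsub).trans ((measure_union_le _ _).trans (by rw [hnull, add_zero]))

lemma abs_liftWells_le (g : Fin κ → ℝ) (x : Icc a b) : |M.liftWells ε g x| ≤ ∑ i, |g i| := by
  refine (Finset.abs_sum_le_sum_abs _ _).trans (Finset.sum_le_sum fun i _ => ?_)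
  rw [abs_mul]
  refine mul_le_of_le_one_right (abs_nonneg _) ?_
  by_cases h : x ∈ M.well ε i <;> simp [h]

lemma liftWells_of_mem (hMap : M.MapAssumptions) (g : Fin κ → ℝ) {i : Fin κ} {x : Icc a b}
    (hx : x ∈ M.well ε i) : M.liftWells ε g x = g i := by
  rw [liftWells, Finset.sum_eq_single i]
  · simp [hx]
  · intro j _ hj
    simp [disjoint_left.mp (M.disjoint_well hMap hj.symm) hx]
  · simp

lemma liftWells_of_notMem (g : Fin κ → ℝ) {x : Icc a b} (hx : x ∉ ⋃ i, M.well ε i) :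
    M.liftWells ε g x = 0 := by
  refine Finset.sum_eq_zero fun i _ => ?_
  have h : x ∉ M.well ε i := fun h => hx (mem_iUnion.mpr ⟨i, h⟩)
  simp [h]

lemma IsResolventSolution.abs_le {M : PerturbedMap a b κ Ω}
    (hT : Measurable fun q : Ω × Icc a b => M.Tε ε q.1 q.2) (hβ : 0 < M.β ε) {lam : ℝ}
    (hlam : 0 < lam) {g : Fin κ → ℝ} {F : Icc a b → ℝ} (hF : M.IsResolventSolution ε lam g F)
    (x : Icc a b) : |F x| ≤ (∑ i, |g i|) / lam := by
  obtain ⟨C, hC⟩ := hF.bounded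
  have : Nonempty (Icc a b) := ⟨x⟩
  have hbdd : BddAbove (range fun x => |F x|) := ⟨C, by rintro _ ⟨y, rfl⟩; exact hC y⟩
  have hs : ∀ y, |F y| ≤ ⨆ z, |F z| := le_ciSup hbdd
  set s := ⨆ z, |F z|
  have hstep : ∀ y, (lam + M.β ε) * |F y| ≤ (∑ i, |g i|) + M.β ε * s := fun y => by
    have := M.isProbabilityMeasure_transitionLaw hT y
    have e := hF.eq y
    rw [M.generator_eq hT hF.measurable hC] at e
    have e2 : (lam + M.β ε) * F y
        = M.liftWells ε g y + M.β ε * ∫ z, F z ∂(M.transitionLaw ε y) := by linarith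
    rw [← abs_of_pos (add_pos hlam hβ), ← abs_mul, e2]
    refine (abs_add_le _ _).trans (add_le_add (M.abs_liftWells_le g y) ?_)
    rw [abs_mul, abs_of_pos hβ]
    exact mul_le_mul_of_nonneg_left (abs_integral_le_of_bdd _ hs) hβ.le
  have h2 : s ≤ ((∑ i, |g i|) + M.β ε * s) / (lam + M.β ε) :=
    ciSup_le fun y => (le_div_iff₀' (add_pos hlam hβ)).mpr (hstep y)
  rw [le_div_iff₀' (add_pos hlam hβ)] at h2
  refine (hs x).trans ((le_div_iff₀' hlam).mpr ?_)
  linarith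

lemma abs_sub_average_le {lam : ℝ} {g : Fin κ → ℝ} [IsProbabilityMeasure (M.μ ε)] {i : Fin κ}
    (hpos : 0 < (M.μ ε).real (M.well ε i)) (hF : Measurable (M.resolvent ε lam g))
    {C : ℝ} (hC : ∀ x, |M.resolvent ε lam g x| ≤ C) {δ : ℝ}
    (hδ : ∀ x ∈ M.well ε i, ∀ y ∈ M.well ε i,
      |M.resolvent ε lam g x - M.resolvent ε lam g y| ≤ δ) {x : Icc a b}
    (hx : x ∈ M.well ε i) : |M.resolvent ε lam g x - M.average ε lam g i| ≤ δ := by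
  have h := abs_setIntegral_sub_le (ν := M.μ ε) hF hC (c := M.resolvent ε lam g x)
    (fun y hy => hδ y hy x hx)
  have e : M.resolvent ε lam g x - M.average ε lam g i
      = -((∫ y in M.well ε i, M.resolvent ε lam g y ∂(M.μ ε)
        - M.resolvent ε lam g x * (M.μ ε).real (M.well ε i)) / (M.μ ε).real (M.well ε i)) := by
    rw [average]; field_simp; ring
  rw [e, abs_neg, abs_div, abs_of_pos hpos, div_le_iff₀ hpos]
  exact h

lemma rate_nonneg (hβ : 0 < M.β ε) (i j : Fin κ) : 0 ≤ M.rate ε i j :=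
  mul_nonneg (div_nonneg hβ.le measureReal_nonneg)
    (integral_nonneg fun _ => measureReal_nonneg)

/-- The averages of `F_ε` over the wells solve the reduced resolvent equation with the rates
`θ_ε`, up to an error that vanishes with the mass of the holes and the oscillation of `F_ε` on
the wells. -/
theorem abs_average_equation_le (hMap : M.MapAssumptions) (hNoise : M.NoiseAssumptions)
    (hACIM : M.UniqueACIM) (hHoles : M.HoleAssumptions) (hβ : M.TimeScale) (hε : 0 < ε)
    {lam : ℝ} (hlam : 0 < lam) (g : Fin κ → ℝ)
    (hpos : ∀ i, 0 < (M.μ ε).real (M.well ε i)) {δ : ℝ}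
    (hδ : ∀ i, ∀ x ∈ M.well ε i, ∀ y ∈ M.well ε i,
      |M.resolvent ε lam g x - M.resolvent ε lam g y| ≤ δ) (i : Fin κ) :
    |lam * M.average ε lam g i - limitGenerator (M.rate ε) (M.average ε lam g) i - g i|
      ≤ (∑ k, |g k|) * (M.μ ε).real (M.holes ε) / (M.μ ε).real (M.well ε i)
        + 2 * δ * ∑ j ∈ Finset.univ.erase i, M.rate ε i j := by
  have hT := hNoise.measurable ε hε
  have hwell := M.measurableSet_well hε hMap hHoles
  have hβ0 := hβ.pos ε hε
  have hF := (M.resolvent_spec hε hlam hMap hNoise hHoles hβ g).1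
  have hC := hF.abs_le hT hβ0 hlam
  obtain ⟨hprob, hac, hinv⟩ := (hACIM ε hε).1
  have hμ : M.transitionKernel hT ∘ₘ M.μ ε = M.μ ε := by
    ext A hA
    rw [Measure.bind_apply hA (Kernel.aemeasurable _)]
    exact hinv A hA
  have hdisj := M.disjoint_well (ε := ε) hMap
  have hFG : ∀ x, lam * M.resolvent ε lam g x - M.β ε *
      (∫ y, M.resolvent ε lam g y ∂(M.transitionKernel hT x) - M.resolvent ε lam g x)
      = M.liftWells ε g x := fun x => by
    rw [← hF.eq x, M.generator_eq hT hF.measurable hC]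
    rfl
  have hmain := abs_reduced_equation_le (M.transitionKernel hT) hwell hdisj hμ i hF.measurable hC
    hlam.le hβ0.le hFG (fun x hx => M.liftWells_of_notMem g hx)
    (fun x hx => M.liftWells_of_mem hMap g hx) (c := M.average ε lam g)
    (fun j x hx => M.abs_sub_average_le (hpos j) hF.measurable hC (hδ j) hx)
  have hrate : ∀ j ∈ Finset.univ.erase i, M.rate ε i j = M.β ε / (M.μ ε).real (M.well ε i) *
      (wellReturn (M.transitionKernel hT) (M.μ ε) (M.well ε) i).real (M.well ε j) := fun j hj => by
    have := isFiniteMeasure_wellReturn (M.transitionKernel hT) hwell hdisj hμ i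
    rw [rate, M.setIntegral_hitProb hT hMap hwell hβ0 (hNoise.absCont ε hε)
      (Finset.ne_of_mem_erase hj).symm (measure_ne_top _ _)]
  set m := (M.μ ε).real (M.well ε i) with hm
  have hm0 : 0 < m := hpos i
  have e1 : limitGenerator (M.rate ε) (M.average ε lam g) i = M.β ε / m *
      ∑ j ∈ Finset.univ.erase i,
        (wellReturn (M.transitionKernel hT) (M.μ ε) (M.well ε) i).real (M.well ε j)
          * (M.average ε lam g j - M.average ε lam g i) := by
    rw [limitGenerator_eq_sum_erase, Finset.mul_sum]
    exact Finset.sum_congr rfl fun j hj => by rw [hrate j hj, mul_assoc]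
  have e2 : ∑ j ∈ Finset.univ.erase i, M.rate ε i j = M.β ε / m * ∑ j ∈ Finset.univ.erase i,
      (wellReturn (M.transitionKernel hT) (M.μ ε) (M.well ε) i).real (M.well ε j) := by
    rw [Finset.mul_sum]
    exact Finset.sum_congr rfl hrate
  have e3 : M.average ε lam g i = (∫ x in M.well ε i, M.resolvent ε lam g x ∂(M.μ ε)) / m := by
    rw [average, inv_mul_eq_div]
  have hholes : (M.μ ε).real (⋃ k, M.well ε k)ᶜ ≤ (M.μ ε).real (M.holes ε) :=
    ENNReal.toReal_mono (measure_ne_top _ _) (M.measure_compl_wells_le hMap hac)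
  have hg0 : 0 ≤ ∑ k, |g k| := Finset.sum_nonneg fun k _ => abs_nonneg _
  have e4 : lam * ((∑ k, |g k|) / lam * (M.μ ε).real (⋃ k, M.well ε k)ᶜ)
      ≤ (∑ k, |g k|) * (M.μ ε).real (M.holes ε) := by
    rw [← mul_assoc, mul_div_cancel₀ _ hlam.ne']
    exact mul_le_mul_of_nonneg_left hholes hg0
  rw [e1, e2]
  set A := ∑ j ∈ Finset.univ.erase i,
        (wellReturn (M.transitionKernel hT) (M.μ ε) (M.well ε) i).real (M.well ε j)
          * (M.average ε lam g j - M.average ε lam g i)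
  set q := ∑ j ∈ Finset.univ.erase i,
      (wellReturn (M.transitionKernel hT) (M.μ ε) (M.well ε) i).real (M.well ε j)
  set J := ∫ x in M.well ε i, M.resolvent ε lam g x ∂(M.μ ε)
  rw [e3, show lam * (J / m) - M.β ε / m * A - g i = (lam * J - g i * m - M.β ε * A) / m by
    field_simp; ring, abs_div, abs_of_pos hm0, div_le_iff₀ hm0, add_mul, div_mul_cancel₀ _ hm0.ne',
    show 2 * δ * (M.β ε / m * q) * m = 2 * M.β ε * δ * q by field_simp]
  linarith

/-! ### The limit of vanishing noise -/

/-- The sum over the wells of the oscillation of the solution of the resolvent equation. -/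
def oscillation (ε lam : ℝ) (g : Fin κ → ℝ) : ℝ :=
  ∑ i, (⨆ x ∈ M.well ε i, ⨆ y ∈ M.well ε i,
    ENNReal.ofReal |M.resolvent ε lam g x - M.resolvent ε lam g y|).toReal

lemma abs_sub_le_oscillation {lam : ℝ} {g : Fin κ → ℝ} {C : ℝ}
    (hC : ∀ x, |M.resolvent ε lam g x| ≤ C) (i : Fin κ) (x : Icc a b) (hx : x ∈ M.well ε i)
    (y : Icc a b) (hy : y ∈ M.well ε i) :
    |M.resolvent ε lam g x - M.resolvent ε lam g y| ≤ M.oscillation ε lam g := by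
  have hfin : (⨆ x ∈ M.well ε i, ⨆ y ∈ M.well ε i,
      ENNReal.ofReal |M.resolvent ε lam g x - M.resolvent ε lam g y|) ≠ ∞ := by
    refine ne_top_of_le_ne_top (ENNReal.ofReal_ne_top (r := C + C)) ?_
    exact iSup₂_le fun x _ => iSup₂_le fun y _ => ENNReal.ofReal_le_ofReal
      ((abs_sub _ _).trans (add_le_add (hC x) (hC y)))
  refine le_trans ?_ (Finset.single_le_sum (fun k _ => ENNReal.toReal_nonneg) (Finset.mem_univ i))
  refine (ENNReal.ofReal_le_iff_le_toReal hfin).mp ?_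
  exact le_iSup₂_of_le x hx (le_iSup₂_of_le y hy le_rfl)

lemma tendsto_oscillation {lam : ℝ} {g : Fin κ → ℝ} (h : M.CondR1 lam g) :
    Tendsto (fun ε => M.oscillation ε lam g) (𝓝[>] 0) (𝓝 0) := by
  have := tendsto_finsetSum (Finset.univ : Finset (Fin κ)) fun i _ =>
    (ENNReal.tendsto_toReal ENNReal.zero_ne_top).comp (h i)
  simpa [oscillation] using this

lemma tendsto_limitGenerator_rate {θ : Fin κ → Fin κ → ℝ} (hH0 : M.RatesConverge θ)
    (f : Fin κ → ℝ) (i : Fin κ) :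
    Tendsto (fun ε => limitGenerator (M.rate ε) f i) (𝓝[>] 0) (𝓝 (limitGenerator θ f i)) := by
  simp only [limitGenerator_eq_sum_erase]
  exact tendsto_finsetSum _ fun j hj => (hH0 i j (Finset.ne_of_mem_erase hj).symm).mul_const _

theorem tendsto_average (hMap : M.MapAssumptions) (hNoise : M.NoiseAssumptions)
    (hACIM : M.UniqueACIM) (hHoles : M.HoleAssumptions) (hβ : M.TimeScale)
    (hA5 : M.NoConcentration) {θ : Fin κ → Fin κ → ℝ} (hH0 : M.RatesConverge θ)
    {lam : ℝ} (hlam : 0 < lam) {g : Fin κ → ℝ} (hR1 : M.CondR1 lam g) {f : Fin κ → ℝ}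
    (hf : ∀ i, lam * f i - limitGenerator θ f i = g i) :
    (∀ i, Tendsto (fun ε => M.average ε lam g i) (𝓝[>] 0) (𝓝 (f i))) ∧
      ∀ i, Tendsto (fun ε => ⨆ x ∈ M.well ε i, ENNReal.ofReal |M.resolvent ε lam g x - f i|)
        (𝓝[>] 0) (𝓝 0) := by
  have hε : ∀ᶠ ε : ℝ in 𝓝[>] 0, 0 < ε := self_mem_nhdsWithin
  have hosc := M.tendsto_oscillation hR1
  have hbdd : ∀ ε > 0, ∀ x, |M.resolvent ε lam g x| ≤ (∑ i, |g i|) / lam := fun ε hε =>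
    (M.resolvent_spec hε hlam hMap hNoise hHoles hβ g).1.abs_le (hNoise.measurable ε hε)
      (hβ.pos ε hε) hlam
  have hreal : ∀ i, ∃ m > 0, Tendsto (fun ε => (M.μ ε).real (M.well ε i)) (𝓝[>] 0) (𝓝 m) := by
    intro i
    obtain ⟨m, hm, hlim⟩ := hA5.wells i
    have hm1 : m ≤ 1 := le_of_tendsto hlim (hε.mono fun ε hε => by
      have := (hACIM ε hε).1.isProb
      exact prob_le_one)
    have hmtop : m ≠ ∞ := ne_top_of_le_ne_top ENNReal.one_ne_top hm1
    exact ⟨m.toReal, ENNReal.toReal_pos hm.ne' hmtop, (ENNReal.tendsto_toReal hmtop).comp hlim⟩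
  choose m hm hmlim using hreal
  have hholes : Tendsto (fun ε => (M.μ ε).real (M.holes ε)) (𝓝[>] 0) (𝓝 0) :=
    (ENNReal.tendsto_toReal ENNReal.zero_ne_top).comp hA5.holes
  have hpos : ∀ᶠ ε in 𝓝[>] (0 : ℝ), ∀ i, 0 < (M.μ ε).real (M.well ε i) :=
    eventually_all.mpr fun i => (hmlim i).eventually (lt_mem_nhds (hm i))
  -- The two sources of error: the averages solve the equation with rates `θ_ε` only
  -- approximately, and these rates differ from their limits.
  set err : ℝ → Fin κ → ℝ := fun ε i =>
    (∑ k, |g k|) * (M.μ ε).real (M.holes ε) / (M.μ ε).real (M.well ε i)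
      + 2 * M.oscillation ε lam g * ∑ j ∈ Finset.univ.erase i, M.rate ε i j
      + |limitGenerator (M.rate ε) f i - limitGenerator θ f i| with herr
  have herr0 : ∀ ε > 0, ∀ i, 0 ≤ err ε i := fun ε hε i => by
    have h1 := Finset.sum_nonneg fun j (_ : j ∈ Finset.univ.erase i) =>
      M.rate_nonneg (hβ.pos ε hε) i j
    have h2 : 0 ≤ M.oscillation ε lam g := Finset.sum_nonneg fun k _ => ENNReal.toReal_nonneg
    have h3 : 0 ≤ ∑ k, |g k| := Finset.sum_nonneg fun k _ => abs_nonneg _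
    positivity
  have herrlim : ∀ i, Tendsto (fun ε => err ε i) (𝓝[>] 0) (𝓝 0) := fun i => by
    have h1 := (hholes.const_mul (∑ k, |g k|)).div (hmlim i) (hm i).ne'
    have h2 := (hosc.const_mul 2).mul (tendsto_finsetSum (Finset.univ.erase i) fun j hj =>
      hH0 i j (Finset.ne_of_mem_erase hj).symm)
    have h3 := ((M.tendsto_limitGenerator_rate hH0 f i).sub_const (limitGenerator θ f i)).abs
    have h := (h1.add h2).add h3
    rwa [mul_zero, zero_div, mul_zero, zero_mul, sub_self, abs_zero, add_zero, add_zero] at h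
  have hsumlim : Tendsto (fun ε => (∑ i, err ε i) / lam) (𝓝[>] 0) (𝓝 0) := by
    simpa using (tendsto_finsetSum Finset.univ fun i _ => herrlim i).div_const lam
  have hclose : ∀ᶠ ε in 𝓝[>] (0 : ℝ), ∀ i,
      |M.average ε lam g i - f i| ≤ (∑ i, err ε i) / lam := by
    filter_upwards [hε, hpos] with ε hε hpos
    refine abs_le_of_abs_resolvent_le (u := fun i => M.average ε lam g i - f i)
      (fun i j _ => M.rate_nonneg (hβ.pos ε hε) i j) hlam fun i => ?_
    have h := M.abs_average_equation_le hMap hNoise hACIM hHoles hβ hε hlam g hpos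
      (M.abs_sub_le_oscillation (hbdd ε hε)) i
    rw [limitGenerator_sub]
    refine le_trans ?_ (Finset.single_le_sum (fun k _ => herr0 ε hε k) (Finset.mem_univ i))
    rw [show lam * (M.average ε lam g i - f i)
        - (limitGenerator (M.rate ε) (fun j => M.average ε lam g j) i
          - limitGenerator (M.rate ε) f i)
      = (lam * M.average ε lam g i - limitGenerator (M.rate ε) (M.average ε lam g) i - g i)
        + (limitGenerator (M.rate ε) f i - limitGenerator θ f i) by rw [← hf i]; ring]
    exact (abs_add_le _ _).trans (add_le_add h le_rfl)
  constructor
  · intro i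
    rw [tendsto_iff_norm_sub_tendsto_zero]
    exact squeeze_zero' (Eventually.of_forall fun _ => norm_nonneg _)
      (hclose.mono fun ε h => h i) hsumlim
  · intro i
    have hlim := ENNReal.tendsto_ofReal (hosc.add hsumlim)
    rw [add_zero, ENNReal.ofReal_zero] at hlim
    refine tendsto_of_tendsto_of_tendsto_of_le_of_le' tendsto_const_nhds hlim
      (Eventually.of_forall fun _ => zero_le) ?_
    filter_upwards [hε, hpos, hclose] with ε hε hpos hclose
    have := (hACIM ε hε).1.isProb
    refine iSup₂_le fun x hx => ENNReal.ofReal_le_ofReal ?_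
    refine (abs_sub_le _ (M.average ε lam g i) _).trans (add_le_add ?_ (hclose i))
    exact M.abs_sub_average_le (hpos i)
      (M.resolvent_spec hε hlam hMap hNoise hHoles hβ g).1.measurable (hbdd ε hε)
      (M.abs_sub_le_oscillation (hbdd ε hε) i) hx

lemma RatesConverge.nonneg {M : PerturbedMap a b κ Ω} {θ : Fin κ → Fin κ → ℝ}
    (hH0 : M.RatesConverge θ) (hβ : M.TimeScale) (i j : Fin κ) (hij : i ≠ j) : 0 ≤ θ i j := by
  have hε : ∀ᶠ ε : ℝ in 𝓝[>] 0, 0 < ε := self_mem_nhdsWithin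
  exact ge_of_tendsto (hH0 i j hij) (hε.mono fun ε hε => M.rate_nonneg (hβ.pos ε hε) i j)

end PerturbedMap
end

theorem proposition3p4 {a b : ℝ} (hab : a < b) {κ : ℕ} {Ω : Type*} [MeasurableSpace Ω]
    (M : PerturbedMap a b κ Ω) (hMap : M.MapAssumptions) (hNoise : M.NoiseAssumptions)
    (hACIM : M.UniqueACIM) (hHoles : M.HoleAssumptions) (hβ : M.TimeScale)
    (hA5 : M.NoConcentration) (θ : Fin κ → Fin κ → ℝ) (hH0 : M.RatesConverge θ) :
    ∀ lam > 0, ∀ g : Fin κ → ℝ, M.CondR1 lam g → M.CondR2 θ lam g ∧ M.CondR θ lam g := by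
  intro lam hlam g hR1
  obtain ⟨f, hf⟩ := PerturbedMap.exists_isReducedSolution (hH0.nonneg hβ) hlam g
  obtain ⟨h2, h3⟩ := M.tendsto_average hMap hNoise hACIM hHoles hβ hA5 hH0 hlam hR1 hf.1
  exact ⟨⟨f, hf, h2⟩, ⟨f, hf, h3⟩⟩
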